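/- For $d>0$ and $n\ge d$ let $G^{\mathrm{bip}}_{n,d}$ be the random bipartite graph with vertex classes $L,R$, each of size $n$, in which every pair in $L\times R$ is an edge independently with probability $d/n$. For $\gamma\in(0,1/2]$, a $\gamma$-balanced independent set of a bipartite graph with classes $(L,R)$ is an independent set $I$ with $\bigl||I\cap L|-\gamma|I|\bigr|<1$, and $X_\gamma$ denotes the size of the largest $\gamma$-balanced independent set of $G^{\mathrm{bip}}_{n,d}$. For every $\gamma\in(0,1/2]$ and every $\varepsilon>0$ there is $d_0$ such that for every real $d\ge d_0$, with probability tending to $1$ as $n\to\infty$, $$\left(\frac{1}{2\gamma(1-\gamma)}-\varepsilon\right)\frac{\log d}{d}\;\le\;\frac{X_\gamma}{2n}\;\le\;\left(\frac{1}{2\gamma(1-\gamma)}+\varepsilon\right)\frac{\log d}{d}.$$ In particular, there is a function $\delta$ with $\delta(d)\to0$ as $d\to\infty$ such that for every sufficiently large $d$, with probability tending to $1$ as $n\to\infty$, the density (size divided by $2n$) of the largest balanced independent set of $G^{\mathrm{bip}}_{n,d}$ lies between $(2-\delta(d))\frac{\log d}{d}$ and $(2+\delta(d))\frac{\log d}{d}$;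 this holds both for $\tfrac12$-balanced independent sets and for independent sets $I$ with exactly $|I\cap L|=|I\cap R|$. -/

import Mathlib

open MeasureTheory ProbabilityTheory Filter Topology

namespace BalancedIndep

/-- The two sides `L` and `R`: `Sum.inl i` is the `i`-th vertex of `L`, `Sum.inr j` the `j`-th
vertex of `R`. -/
abbrev Vertex (n : ℕ) : Type := Fin n ⊕ Fin n

/-- The bipartite graph on `(L, R)` whose edges in `L × R` are the pairs `(i, j)` with
`A (i, j) = true`. -/
def bipGraph {n : ℕ} (A : Fin n × Fin n → Bool) : SimpleGraph (Vertex n) where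
  Adj
    | Sum.inl i, Sum.inr j => A (i, j) = true
    | Sum.inr j, Sum.inl i => A (i, j) = true
    | _, _ => False
  symm := ⟨by rintro (i | i) (j | j) h <;> exact h⟩
  loopless := ⟨by rintro (i | i) h <;> exact h⟩

/-- The edge probability `d / n`, truncated to `[0, 1]`; the truncation only matters when
`n < d` (or `d < 0`). -/
noncomputable def edgeProb (n : ℕ) (d : ℝ) : unitInterval :=
  Set.projIcc (0 : ℝ) 1 zero_le_one (d / n)

/-- The law of the edge indicators of the bipartite Erdős–Rényi random graph: independent
Bernoulli variables of parameter `d / n`, one for each pair in `L × R`. -/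
noncomputable def bipLaw (n : ℕ) (d : ℝ) : Measure (Fin n × Fin n → Bool) :=
  Measure.pi fun _ => bernoulliMeasure true false (edgeProb n d)

/-- `I` is a `γ`-balanced independent set: it is independent and `| |I ∩ L| - γ |I| | < 1`. -/
def IsGammaBalancedIndep {n : ℕ} (γ : ℝ) (G : SimpleGraph (Vertex n))
    (I : Finset (Vertex n)) : Prop :=
  G.IsIndepSet (I : Set (Vertex n)) ∧ |(I.toLeft.card : ℝ) - γ * (I.card : ℝ)| < 1

/-- `I` is a balanced independent set: it is independent and has equally many vertices in
`L` and in `R`. -/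
def IsBalancedIndep {n : ℕ} (G : SimpleGraph (Vertex n)) (I : Finset (Vertex n)) : Prop :=
  G.IsIndepSet (I : Set (Vertex n)) ∧ I.toLeft.card = I.toRight.card

open Classical in
/-- The size of the largest `γ`-balanced independent set (the empty set is always one). -/
noncomputable def maxGammaBalanced {n : ℕ} (γ : ℝ) (G : SimpleGraph (Vertex n)) : ℕ :=
  (Finset.univ.filter (IsGammaBalancedIndep γ G)).sup Finset.card

open Classical in
/-- The size of the largest balanced independent set (the empty set is always one). -/
noncomputable def maxBalanced {n : ℕ} (G : SimpleGraph (Vertex n)) : ℕ :=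
  (Finset.univ.filter (IsBalancedIndep G)).sup Finset.card

/-- With high probability as `n → ∞` (for fixed `d`), the property `P` holds for the random
bipartite graph with `n` vertices on each side and edge probability `d / n`. -/
def Whp (d : ℝ) (P : ∀ n : ℕ, SimpleGraph (Vertex n) → Prop) : Prop :=
  Tendsto (fun n : ℕ => (bipLaw n d).real {A | P n (bipGraph A)}) atTop (𝓝 1)

end BalancedIndep

namespace BalancedIndep

/-! ### Finite product expectations and bounded differences -/

/-! An independent set is a pair `S ⊆ L`, `T ⊆ R` spanning no edge, so the question is for which
densities `a`, `b` an empty `an × bn` rectangle exists. Up to lower-order terms the expected number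
of such rectangles is `exp (n (a + a log (1/a) + b + b log (1/b) - d a b))`. With `a = γσ`, `b =
(1-γ)σ`, `σ = K log d / d`, the entropy is about `σ log d` and the penalty is `γ(1-γ)K · σ log d`.
The sign changes at `K = 1/(γ(1-γ))`; dividing the size `σn` by `2n` gives the stated constant.
Above the threshold the first moment suffices (`tendsto_hasEmptyRect_zero`).

Below it, the second moment is compared with the squared first moment by the overlap sizes of two
rectangles (`one_le_mul_probOf_rect`). The estimate `overlapRate_add_le` bounds the ratio by a
polynomial times `exp (δn)`, where `δ` is of order `d a² b²`, that is `(log d)⁴ / d³`. So a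
rectangle is only known to exist with probability at least about `exp (-δn)`.

Concentration repairs this. For fixed `l`, the largest number of common non-neighbours of an
`l`-subset of `R` changes by at most one when one row of the adjacency matrix is resampled. The
two-tail inequality `tail_mul_tail_le` bounds the product of the probabilities of reaching `k` and
of staying below `k - τn` by `exp (-nτ²/8)`. Taking `τ` a small multiple of `log d / d` gives `τ²/8
> δ` for large `d`, so the second probability tends to zero and the loss `τn` is negligible against
`k`. -/

/-- The weight of `x` under the product of the weights `W` on `α`. -/
def prodWeight {ι α : Type*} [Fintype ι] (W : α → ℝ) (x : ι → α) : ℝ := ∏ i, W (x i)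

lemma prodWeight_nonneg {ι α : Type*} [Fintype ι] {W : α → ℝ} (hW : ∀ a, 0 ≤ W a) (x : ι → α) :
    0 ≤ prodWeight W x := Finset.prod_nonneg fun _ _ => hW _

lemma sum_prodWeight {ι α : Type*} [Fintype ι] [DecidableEq ι] [Fintype α] {W : α → ℝ}
    (h1 : ∑ a, W a = 1) : ∑ x : ι → α, prodWeight W x = 1 := by
  unfold prodWeight
  rw [← Fintype.prod_sum]
  simp [h1]

lemma sum_prodWeight_succ {α : Type*} [Fintype α] {W : α → ℝ} {n : ℕ}
    (f : (Fin (n + 1) → α) → ℝ) :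
    ∑ x, prodWeight W x * f x =
      ∑ x : Fin n → α, prodWeight W x * ∑ a, W a * f (Fin.cons a x) := by
  rw [← (Fin.consEquiv fun _ => α).sum_comp, Fintype.sum_prod_type, Finset.sum_comm]
  refine Finset.sum_congr rfl fun x _ => ?_
  rw [Finset.mul_sum]
  refine Finset.sum_congr rfl fun a _ => ?_
  simp [Fin.consEquiv, prodWeight, Fin.prod_univ_succ]
  ring

/-- A one-variable Hoeffding-type bound with a crude constant. -/
lemma sum_mul_exp_le {α : Type*} [Fintype α] {W : α → ℝ} (hW : ∀ a, 0 ≤ W a)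
    (h1 : ∑ a, W a = 1) {h : α → ℝ} (hh : ∀ a b, |h a - h b| ≤ 1) {t : ℝ} (ht : |t| ≤ 1) :
    ∑ a, W a * Real.exp (t * h a) ≤ Real.exp (t ^ 2) * Real.exp (t * ∑ a, W a * h a) := by
  set m := ∑ a, W a * h a with hm
  have hdev : ∀ a, |h a - m| ≤ 1 := by
    intro a
    have : h a - m = ∑ b, W b * (h a - h b) := by
      simp only [mul_sub, Finset.sum_sub_distrib, ← Finset.sum_mul, h1, one_mul, hm]
    rw [this]
    refine (Finset.abs_sum_le_sum_abs _ _).trans ?_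
    rw [← h1]
    refine Finset.sum_le_sum fun b _ => ?_
    rw [abs_mul, abs_of_nonneg (hW b)]
    exact mul_le_of_le_one_right (hW b) (hh a b)
  -- `e^x ≤ 1 + x + x²` holds for `|x| ≤ 1`, which is where `|t| ≤ 1` enters. The linear term
  -- averages to zero.
  have hkey : ∀ a, Real.exp (t * (h a - m)) ≤ 1 + t * (h a - m) + t ^ 2 := by
    intro a
    have hx : |t * (h a - m)| ≤ 1 := by
      rw [abs_mul]; exact mul_le_one₀ ht (abs_nonneg _) (hdev a)
    have h2 := (abs_le.1 (Real.abs_exp_sub_one_sub_id_le hx)).2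
    have h3 : (t * (h a - m)) ^ 2 ≤ t ^ 2 := by
      rw [mul_pow]
      refine mul_le_of_le_one_right (sq_nonneg t) ?_
      rw [← sq_abs]
      exact pow_le_one₀ (abs_nonneg _) (hdev a)
    linarith
  have hsum : ∑ a, W a * Real.exp (t * (h a - m)) ≤ 1 + t ^ 2 := by
    calc ∑ a, W a * Real.exp (t * (h a - m))
        ≤ ∑ a, W a * (1 + t * (h a - m) + t ^ 2) :=
          Finset.sum_le_sum fun a _ => mul_le_mul_of_nonneg_left (hkey a) (hW a)
      _ = ∑ a, (W a * (1 + t ^ 2 - t * m) + t * (W a * h a)) :=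
          Finset.sum_congr rfl fun a _ => by ring
      _ = 1 + t ^ 2 := by
          rw [Finset.sum_add_distrib, ← Finset.sum_mul, ← Finset.mul_sum, h1, ← hm]; ring
  have hfac : ∑ a, W a * Real.exp (t * h a)
      = (∑ a, W a * Real.exp (t * (h a - m))) * Real.exp (t * m) := by
    rw [Finset.sum_mul]
    refine Finset.sum_congr rfl fun a _ => ?_
    rw [mul_assoc, ← Real.exp_add]
    ring_nf
  rw [hfac]
  refine mul_le_mul_of_nonneg_right (hsum.trans ?_) (Real.exp_pos _).le
  linarith [Real.add_one_le_exp (t ^ 2)]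

/-- The exponential moment bound behind McDiarmid's inequality. -/
lemma sum_prodWeight_mul_exp_le {α : Type*} [Fintype α] {W : α → ℝ} (hW : ∀ a, 0 ≤ W a)
    (h1 : ∑ a, W a = 1) {t : ℝ} (ht : |t| ≤ 1) (n : ℕ) (f : (Fin n → α) → ℝ)
    (hf : ∀ x i a, |f (Function.update x i a) - f x| ≤ 1) :
    ∑ x, prodWeight W x * Real.exp (t * f x)
      ≤ Real.exp (n * t ^ 2) * Real.exp (t * ∑ x, prodWeight W x * f x) := by
  induction n with
  | zero => simp [prodWeight]
  | succ n ih =>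
    -- Averaging out the first coordinate preserves both the mean and the bounded differences, so
    -- the induction peels off one factor `exp (t²)` per coordinate.
    set g : (Fin n → α) → ℝ := fun x => ∑ a, W a * f (Fin.cons a x) with hg
    have hgd : ∀ x i a, |g (Function.update x i a) - g x| ≤ 1 := by
      intro x i a
      rw [hg]
      simp only
      rw [← Finset.sum_sub_distrib, ← h1]
      refine (Finset.abs_sum_le_sum_abs _ _).trans (Finset.sum_le_sum fun b _ => ?_)
      rw [← mul_sub, abs_mul, abs_of_nonneg (hW b), Fin.cons_update]
      exact mul_le_of_le_one_right (hW b) (hf _ _ _)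
    rw [sum_prodWeight_succ f, sum_prodWeight_succ fun x => Real.exp (t * f x)]
    calc ∑ x : Fin n → α, prodWeight W x * ∑ a, W a * Real.exp (t * f (Fin.cons a x))
        ≤ ∑ x : Fin n → α, prodWeight W x * (Real.exp (t ^ 2) * Real.exp (t * g x)) := by
          refine Finset.sum_le_sum fun x _ =>
            mul_le_mul_of_nonneg_left ?_ (prodWeight_nonneg hW x)
          refine sum_mul_exp_le hW h1 (fun a b => ?_) ht
          have := hf (Fin.cons b x) 0 a
          rwa [Fin.update_cons_zero] at this
      _ = Real.exp (t ^ 2) * ∑ x : Fin n → α, prodWeight W x * Real.exp (t * g x) := by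
          rw [Finset.mul_sum]; exact Finset.sum_congr rfl fun x _ => by ring
      _ ≤ Real.exp (t ^ 2) * (Real.exp (n * t ^ 2)
            * Real.exp (t * ∑ x, prodWeight W x * g x)) :=
          mul_le_mul_of_nonneg_left (ih g hgd) (Real.exp_pos _).le
      _ = _ := by
          rw [← mul_assoc, ← Real.exp_add]
          congr 2
          push_cast
          ring

open Classical in
/-- The total weight of the points with property `P`. -/
noncomputable def probOf {Ω : Type*} [Fintype Ω] (w : Ω → ℝ) (P : Ω → Prop) : ℝ :=
  ∑ x with P x, w x

lemma probOf_eq_sum_ite {Ω : Type*} [Fintype Ω] (w : Ω → ℝ) (P : Ω → Prop) [DecidablePred P] :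
    probOf w P = ∑ x, if P x then w x else 0 := by
  rw [probOf, Finset.sum_filter]
  exact Finset.sum_congr rfl fun x _ => by congr

lemma probOf_nonneg {Ω : Type*} [Fintype Ω] {w : Ω → ℝ} (hw : ∀ x, 0 ≤ w x) (P : Ω → Prop) :
    0 ≤ probOf w P := Finset.sum_nonneg fun x _ => hw x

lemma probOf_mono {Ω : Type*} [Fintype Ω] {w : Ω → ℝ} (hw : ∀ x, 0 ≤ w x) {P Q : Ω → Prop}
    (h : ∀ x, P x → Q x) : probOf w P ≤ probOf w Q := by
  classical
  exact Finset.sum_le_sum_of_subset_of_nonneg (Finset.monotone_filter_right _ fun x _ => h x)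
    fun x _ _ => hw x

/-- Markov's inequality for exponential moments. -/
lemma probOf_mul_exp_le {Ω : Type*} [Fintype Ω] {w : Ω → ℝ} (hw : ∀ x, 0 ≤ w x)
    (f : Ω → ℝ) (c : ℝ) :
    probOf w (fun x => c ≤ f x) * Real.exp c ≤ ∑ x, w x * Real.exp (f x) := by
  classical
  rw [probOf, Finset.sum_mul]
  calc ∑ x with c ≤ f x, w x * Real.exp c ≤ ∑ x with c ≤ f x, w x * Real.exp (f x) := by
        refine Finset.sum_le_sum fun x hx => mul_le_mul_of_nonneg_left ?_ (hw x)
        exact Real.exp_le_exp.2 (Finset.mem_filter.1 hx).2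
    _ ≤ _ := Finset.sum_le_univ_sum_of_nonneg fun x => mul_nonneg (hw x) (Real.exp_pos _).le

/-- Two-sided deviation bound for functions with bounded differences: both tails of `f` cannot be
heavy at distance linear in `n`. -/
lemma tail_mul_tail_le {α : Type*} [Fintype α] {W : α → ℝ} (hW : ∀ a, 0 ≤ W a)
    (h1 : ∑ a, W a = 1) {t : ℝ} (ht0 : 0 < t) (ht : t ≤ 1) (n : ℕ) (f : (Fin n → α) → ℝ)
    (hf : ∀ x i a, |f (Function.update x i a) - f x| ≤ 1) (u v : ℝ) :
    probOf (prodWeight W) (fun x => u ≤ f x) * probOf (prodWeight W) (fun x => f x ≤ v)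
      ≤ Real.exp (2 * n * t ^ 2 - t * (u - v)) := by
  have hw := fun x : Fin n → α => prodWeight_nonneg hW x
  set m := ∑ x, prodWeight W x * f x
  have hup : probOf (prodWeight W) (fun x => u ≤ f x) * Real.exp (t * u)
      ≤ Real.exp (n * t ^ 2) * Real.exp (t * m) := by
    refine le_trans ?_ (sum_prodWeight_mul_exp_le hW h1 (by rwa [abs_of_pos ht0]) n f hf)
    refine le_trans (le_of_eq ?_) (probOf_mul_exp_le hw (fun x => t * f x) (t * u))
    simp only [mul_le_mul_iff_right₀ ht0]
  have hlo : probOf (prodWeight W) (fun x => f x ≤ v) * Real.exp (-t * v)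
      ≤ Real.exp (n * t ^ 2) * Real.exp (-t * m) := by
    have h := sum_prodWeight_mul_exp_le hW h1 (t := -t) (by rwa [abs_neg, abs_of_pos ht0]) n f hf
    rw [neg_sq] at h
    refine le_trans ?_ h
    refine le_trans (le_of_eq ?_) (probOf_mul_exp_le hw (fun x => -t * f x) (-t * v))
    simp only [neg_mul, neg_le_neg_iff, mul_le_mul_iff_right₀ ht0]
  have hmul := mul_le_mul hup hlo (mul_nonneg (probOf_nonneg hw _)
    (Real.exp_pos _).le) (by positivity)
  -- The unknown mean `m` cancels in the product of the two tails; it never has to be located.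
  have hR : Real.exp (n * t ^ 2) * Real.exp (t * m) * (Real.exp (n * t ^ 2) * Real.exp (-t * m))
      = Real.exp (2 * n * t ^ 2) := by
    rw [← Real.exp_add, ← Real.exp_add, ← Real.exp_add]; ring_nf
  have hL : ∀ P Q : ℝ, P * Real.exp (t * u) * (Q * Real.exp (-t * v))
      = P * Q * Real.exp (t * (u - v)) := by
    intro P Q
    rw [mul_mul_mul_comm, ← Real.exp_add]; ring_nf
  rw [hR, hL] at hmul
  rw [Real.exp_sub, le_div_iff₀ (Real.exp_pos _)]
  exact hmul

/-! ### The law of the random bipartite graph as a finite sum -/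

/-- Bernoulli weights. -/
def bernWeight (p : ℝ) (b : Bool) : ℝ := if b then p else 1 - p

lemma bernWeight_nonneg {p : ℝ} (h0 : 0 ≤ p) (h1 : p ≤ 1) (b : Bool) : 0 ≤ bernWeight p b := by
  cases b <;> simp [bernWeight, h0, h1]

lemma sum_bernWeight (p : ℝ) : ∑ b, bernWeight p b = 1 := by simp [bernWeight]

instance (n : ℕ) (d : ℝ) : IsProbabilityMeasure (bipLaw n d) := by
  unfold bipLaw; infer_instance

/-- The space is finite and discrete, so probabilities reduce to real-valued weighted sums. -/
lemma bipLaw_real_eq (n : ℕ) (d : ℝ) (P : (Fin n × Fin n → Bool) → Prop) :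
    (bipLaw n d).real {A | P A} = probOf (prodWeight (bernWeight (edgeProb n d))) P := by
  classical
  have h : {A | P A} = ((Finset.univ.filter P : Finset _) : Set (Fin n × Fin n → Bool)) := by
    ext; simp
  rw [h, ← sum_measureReal_singleton, probOf]
  refine Finset.sum_congr rfl fun A _ => ?_
  rw [bipLaw, measureReal_def, Measure.pi_singleton, ENNReal.toReal_prod, prodWeight]
  refine Finset.prod_congr rfl fun e _ => ?_
  rw [← measureReal_def, bernoulliMeasure_real_apply _ (measurableSet_singleton _)]
  cases A e <;> simp [bernWeight]

/-- The probability that a given set of pairs contains no edge. -/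
lemma probOf_avoid (p : ℝ) {ι : Type*} [Fintype ι] [DecidableEq ι] (F : Finset ι) :
    probOf (prodWeight (bernWeight p)) (fun A : ι → Bool => ∀ e ∈ F, A e = false)
      = (1 - p) ^ F.card := by
  classical
  -- The weight restricted to the event is still a product over coordinates, so the sum factorises.
  have h : ∀ A : ι → Bool, (if ∀ e ∈ F, A e = false then prodWeight (bernWeight p) A else 0)
      = ∏ e, (if e ∈ F ∧ A e = true then 0 else bernWeight p (A e)) := by
    intro A
    split_ifs with hA
    · refine Finset.prod_congr rfl fun e _ => ?_
      rw [if_neg]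
      rintro ⟨he, h⟩
      simp [hA e he] at h
    · push Not at hA
      obtain ⟨e, he, h⟩ := hA
      refine (Finset.prod_eq_zero (Finset.mem_univ e) ?_).symm
      rw [if_pos ⟨he, by simpa using h⟩]
  rw [probOf_eq_sum_ite, Finset.sum_congr rfl fun A _ => h A,
    ← Fintype.prod_sum fun (e : ι) (b : Bool) => if e ∈ F ∧ b = true then 0 else bernWeight p b]
  have h2 : ∀ e : ι, (∑ b : Bool, if e ∈ F ∧ b = true then 0 else bernWeight p b)
      = if e ∈ F then 1 - p else 1 := by
    intro e
    by_cases he : e ∈ F <;> simp [he, bernWeight]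
  rw [Finset.prod_congr rfl fun e _ => h2 e, Finset.prod_ite_mem, Finset.univ_inter,
    Finset.prod_const]

/-- Regrouping a function of the pairs by rows. -/
lemma sum_prodWeight_rows {n : ℕ} (p : ℝ) (F : (Fin n × Fin n → Bool) → ℝ) :
    ∑ A, prodWeight (bernWeight p) A * F A =
      ∑ x : Fin n → Fin n → Bool,
        prodWeight (prodWeight (bernWeight p)) x * F (Function.uncurry x) := by
  rw [← (Equiv.curry (Fin n) (Fin n) Bool).symm.sum_comp]
  refine Finset.sum_congr rfl fun x _ => ?_
  congr 1
  simp [prodWeight, Fintype.prod_prod_type, Equiv.curry]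

/-! ### Overlaps of random subsets -/

/-- A uniform `k`-set contains a given `i`-set with probability `∏ (k-j)/(n-j)` over `j < i`, and
each factor is at most `k/n`. -/
lemma choose_sub_mul_pow_le {n k i : ℕ} (hk : k ≤ n) (hi : i ≤ k) :
    (n - i).choose (k - i) * n ^ i ≤ n.choose k * k ^ i := by
  induction i with
  | zero => simp
  | succ i ih =>
    have ih := ih (by omega)
    obtain ⟨a, ha⟩ : ∃ a, n - i = a + 1 := ⟨n - i - 1, by omega⟩
    obtain ⟨b, hb⟩ : ∃ b, k - i = b + 1 := ⟨k - i - 1, by omega⟩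
    have e1 : n - (i + 1) = a := by omega
    have e2 : k - (i + 1) = b := by omega
    rw [ha, hb] at ih
    rw [e1, e2]
    have h := Nat.add_one_mul_choose_eq a b
    have hab : (b + 1) * n ≤ (a + 1) * k := by
      have hn : n = a + 1 + i := by omega
      have hk' : k = b + 1 + i := by omega
      have : b ≤ a := by omega
      rw [hn, hk']
      nlinarith
    refine Nat.le_of_mul_le_mul_left ?_ (Nat.succ_pos a)
    calc (a + 1) * (a.choose b * n ^ (i + 1)) = (a + 1) * a.choose b * n * n ^ i := by ring
      _ = (a + 1).choose (b + 1) * n ^ i * ((b + 1) * n) := by rw [h]; ring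
      _ ≤ n.choose k * k ^ i * ((a + 1) * k) := Nat.mul_le_mul ih hab
      _ = (a + 1) * (n.choose k * k ^ (i + 1)) := by ring

lemma card_superset_powersetCard {n k : ℕ} (U : Finset (Fin n)) :
    ((Finset.univ.powersetCard k).filter fun S : Finset (Fin n) => U ⊆ S).card
      ≤ (n - U.card).choose (k - U.card) := by
  have hc : (n - U.card).choose (k - U.card) = (Uᶜ.powersetCard (k - U.card)).card := by
    rw [Finset.card_powersetCard, Finset.card_compl, Fintype.card_fin]
  rw [hc]
  refine Finset.card_le_card_of_injOn (fun S => S \ U) ?_ ?_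
  · intro S hS
    simp only [Finset.coe_filter, Finset.mem_powersetCard, Set.mem_ofPred_eq] at hS
    simp only [Finset.mem_coe, Finset.mem_powersetCard]
    refine ⟨?_, by rw [Finset.card_sdiff_of_subset hS.2, hS.1.2]⟩
    intro x hx
    simp only [Finset.mem_sdiff] at hx
    simpa using hx.2
  · intro S hS S' hS' h
    simp only [Finset.coe_filter, Finset.mem_powersetCard, Set.mem_ofPred_eq] at hS hS'
    simp only at h
    rw [← Finset.sdiff_union_of_subset hS.2, h, Finset.sdiff_union_of_subset hS'.2]

/-- Union bound over the possible intersections `U = S ∩ S'`. -/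
lemma card_overlap_le {n k i : ℕ} {S : Finset (Fin n)} (hS : S.card = k) :
    ((Finset.univ.powersetCard k).filter fun S' : Finset (Fin n) => (S ∩ S').card = i).card
      ≤ k.choose i * (n - i).choose (k - i) := by
  calc _ ≤ ((S.powersetCard i).biUnion fun U =>
        (Finset.univ.powersetCard k).filter fun S' : Finset (Fin n) => U ⊆ S').card := by
        refine Finset.card_le_card fun S' hS' => ?_
        rw [Finset.mem_filter] at hS'
        refine Finset.mem_biUnion.2 ⟨S ∩ S', ?_, ?_⟩
        · exact Finset.mem_powersetCard.2 ⟨Finset.inter_subset_left, hS'.2⟩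
        · exact Finset.mem_filter.2 ⟨hS'.1, Finset.inter_subset_right⟩
    _ ≤ ∑ U ∈ S.powersetCard i, (n - i).choose (k - i) := by
        refine Finset.card_biUnion_le.trans (Finset.sum_le_sum fun U hU => ?_)
        have hU := (Finset.mem_powersetCard.1 hU).2
        have := card_superset_powersetCard (k := k) U
        rwa [hU] at this
    _ = _ := by rw [Finset.sum_const, Finset.card_powersetCard, hS, smul_eq_mul]

/-- An upper bound for the probability that two random `k`-subsets of an `n`-set meet in `i`
points. -/
noncomputable def overlapBound (n k i : ℕ) : ℝ := min 1 (k.choose i * ((k : ℝ) / n) ^ i)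

lemma overlapBound_nonneg (n k i : ℕ) : 0 ≤ overlapBound n k i := le_min zero_le_one (by positivity)

lemma card_overlap_le_overlapBound {n k i : ℕ} {S : Finset (Fin n)} (hS : S.card = k)
    (hi : i ≤ k) :
    (((Finset.univ.powersetCard k).filter
      fun S' : Finset (Fin n) => (S ∩ S').card = i).card : ℝ)
      ≤ n.choose k * overlapBound n k i := by
  have hk : k ≤ n := by simpa [hS] using Finset.card_le_univ S
  rw [overlapBound, mul_min_of_nonneg _ _ (Nat.cast_nonneg _), mul_one]
  refine le_min ?_ ?_
  · have := Finset.card_filter_le (Finset.univ.powersetCard k)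
      fun S' : Finset (Fin n) => (S ∩ S').card = i
    rw [Finset.card_powersetCard, Finset.card_univ, Fintype.card_fin] at this
    exact_mod_cast this
  · have h1 : (((Finset.univ.powersetCard k).filter
      fun S' : Finset (Fin n) => (S ∩ S').card = i).card : ℝ)
        ≤ k.choose i * (n - i).choose (k - i) := by exact_mod_cast card_overlap_le hS
    have h2 : ((n - i).choose (k - i) : ℝ) * n ^ i ≤ n.choose k * k ^ i := by
      exact_mod_cast choose_sub_mul_pow_le hk hi
    refine h1.trans ?_
    rcases Nat.eq_zero_or_pos n with rfl | hn
    · have : k = 0 := by omega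
      subst this
      have : i = 0 := by omega
      subst this
      simp
    · have hn' : (0 : ℝ) < n ^ i := by positivity
      rw [mul_left_comm]
      refine mul_le_mul_of_nonneg_left ?_ (Nat.cast_nonneg _)
      rw [div_pow, mul_div_assoc', le_div_iff₀ hn']
      exact h2

lemma sum_overlap {n k : ℕ} {S : Finset (Fin n)} (hS : S.card = k) (φ : ℕ → ℝ) :
    ∑ S' ∈ Finset.univ.powersetCard k, φ (S ∩ S').card
      = ∑ i ∈ Finset.range (k + 1), (((Finset.univ.powersetCard k).filter
          fun S' : Finset (Fin n) => (S ∩ S').card = i).card : ℝ) * φ i := by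
  rw [← Finset.sum_fiberwise_of_maps_to (g := fun S' : Finset (Fin n) => (S ∩ S').card)
    (t := Finset.range (k + 1))]
  · refine Finset.sum_congr rfl fun i _ => ?_
    rw [Finset.sum_congr rfl fun S' hS' => by rw [(Finset.mem_filter.1 hS').2],
      Finset.sum_const, nsmul_eq_mul]
  · intro S' _
    rw [Finset.mem_range, Nat.lt_succ_iff, ← hS]
    exact Finset.card_le_card Finset.inter_subset_left

lemma sum_overlap_le {n k : ℕ} {S : Finset (Fin n)} (hS : S.card = k) {φ : ℕ → ℝ}
    (hφ : ∀ i, 0 ≤ φ i) :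
    ∑ S' ∈ Finset.univ.powersetCard k, φ (S ∩ S').card
      ≤ n.choose k * ∑ i ∈ Finset.range (k + 1), overlapBound n k i * φ i := by
  rw [sum_overlap hS, Finset.mul_sum]
  refine Finset.sum_le_sum fun i hi => ?_
  rw [← mul_assoc]
  exact mul_le_mul_of_nonneg_right
    (card_overlap_le_overlapBound hS (Nat.lt_succ_iff.1 (Finset.mem_range.1 hi))) (hφ i)

/-! ### First and second moments of the number of empty rectangles -/

/-- No pair of `S × T` is an edge. -/
def IsEmptyRect {n : ℕ} (A : Fin n × Fin n → Bool) (S T : Finset (Fin n)) : Prop :=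
  ∀ e ∈ S ×ˢ T, A e = false

/-- The pairs of a `k`-subset of `L` and an `l`-subset of `R`. -/
def rects (n k l : ℕ) : Finset (Finset (Fin n) × Finset (Fin n)) :=
  Finset.univ.powersetCard k ×ˢ Finset.univ.powersetCard l

lemma mem_rects {n k l : ℕ} {z : Finset (Fin n) × Finset (Fin n)} :
    z ∈ rects n k l ↔ z.1.card = k ∧ z.2.card = l := by
  simp [rects, Finset.mem_powersetCard]

lemma card_rects (n k l : ℕ) : (rects n k l).card = n.choose k * n.choose l := by
  simp [rects]

open Classical in
/-- The number of empty `k × l` rectangles. -/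
noncomputable def rectCount {n : ℕ} (k l : ℕ) (A : Fin n × Fin n → Bool) : ℝ :=
  ∑ z ∈ rects n k l, if IsEmptyRect A z.1 z.2 then 1 else 0

lemma sum_weight_mul_rectCount (n k l : ℕ) (p : ℝ) :
    ∑ A : Fin n × Fin n → Bool, prodWeight (bernWeight p) A * rectCount k l A
      = n.choose k * n.choose l * (1 - p) ^ (k * l) := by
  classical
  simp only [rectCount, Finset.mul_sum]
  rw [Finset.sum_comm]
  have h : ∀ z ∈ rects n k l, (∑ A : Fin n × Fin n → Bool, prodWeight (bernWeight p) A *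
      if IsEmptyRect A z.1 z.2 then 1 else 0) = (1 - p) ^ (k * l) := by
    intro z hz
    obtain ⟨h1, h2⟩ := mem_rects.1 hz
    simp only [mul_ite, mul_one, mul_zero]
    have := probOf_avoid p (z.1 ×ˢ z.2)
    rw [Finset.card_product, h1, h2] at this
    rw [← this]
    rw [probOf_eq_sum_ite]
    exact Finset.sum_congr rfl fun A _ => if_congr Iff.rfl rfl rfl
  rw [Finset.sum_congr rfl h, Finset.sum_const, card_rects, nsmul_eq_mul]
  push_cast
  ring

lemma sum_weight_mul_rectCount_sq (n k l : ℕ) (p : ℝ) :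
    ∑ A : Fin n × Fin n → Bool, prodWeight (bernWeight p) A * rectCount k l A ^ 2
      = ∑ z ∈ rects n k l, ∑ z' ∈ rects n k l,
          (1 - p) ^ (z.1 ×ˢ z.2 ∪ z'.1 ×ˢ z'.2).card := by
  classical
  simp only [rectCount, sq]
  simp only [Finset.sum_mul_sum]
  simp only [Finset.mul_sum]
  rw [Finset.sum_comm]
  refine Finset.sum_congr rfl fun z _ => ?_
  rw [Finset.sum_comm]
  refine Finset.sum_congr rfl fun z' _ => ?_
  rw [← probOf_avoid p (z.1 ×ˢ z.2 ∪ z'.1 ×ˢ z'.2), probOf_eq_sum_ite]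
  refine Finset.sum_congr rfl fun A _ => ?_
  simp only [Finset.mem_union, or_imp, forall_and]
  by_cases h1 : IsEmptyRect A z.1 z.2 <;> by_cases h2 : IsEmptyRect A z'.1 z'.2 <;>
    simp only [h1, h2, if_true, if_false, mul_one, mul_zero]
  · rw [if_pos ⟨h1, h2⟩]
  · rw [if_neg fun h => h2 h.2]
  · rw [if_neg fun h => h1 h.1]
  · rw [if_neg fun h => h1 h.1]

/-- Two rectangles meet in the rectangle of their side overlaps, so the correlation depends only on
the product of the two overlap sizes. -/
lemma pow_card_union_rect {n k l : ℕ} {q : ℝ} (hq : q ≠ 0)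
    {z z' : Finset (Fin n) × Finset (Fin n)} (hz : z ∈ rects n k l) (hz' : z' ∈ rects n k l) :
    q ^ (z.1 ×ˢ z.2 ∪ z'.1 ×ˢ z'.2).card
      = q ^ (k * l) * q ^ (k * l) * q⁻¹ ^ ((z.1 ∩ z'.1).card * (z.2 ∩ z'.2).card) := by
  have h := Finset.card_union_add_card_inter (z.1 ×ˢ z.2) (z'.1 ×ˢ z'.2)
  rw [Finset.product_inter_product, Finset.card_product, Finset.card_product, Finset.card_product,
    (mem_rects.1 hz).1, (mem_rects.1 hz).2, (mem_rects.1 hz').1, (mem_rects.1 hz').2] at h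
  rw [← pow_add, ← h, pow_add, mul_assoc, ← mul_pow, mul_inv_cancel₀ hq, one_pow, mul_one]

/-- The second moment method for empty rectangles. -/
lemma one_le_mul_probOf_rect {n k l : ℕ} (hk : k ≤ n) (hl : l ≤ n) {p : ℝ} (h0 : 0 ≤ p)
    (h1 : p < 1) {B : ℝ}
    (hB : ∀ i ≤ k, ∀ j ≤ l,
      overlapBound n k i * overlapBound n l j * (1 - p)⁻¹ ^ (i * j) ≤ B) :
    1 ≤ (k + 1) * (l + 1) * B * probOf (prodWeight (bernWeight p))
      fun A : Fin n × Fin n → Bool => ∃ z ∈ rects n k l, IsEmptyRect A z.1 z.2 := by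
  classical
  set q := 1 - p with hq
  have hq0 : 0 < q := by linarith
  have hw := fun A : Fin n × Fin n → Bool =>
    prodWeight_nonneg (bernWeight_nonneg h0 h1.le) A
  set Q := probOf (prodWeight (bernWeight p))
      fun A : Fin n × Fin n → Bool => ∃ z ∈ rects n k l, IsEmptyRect A z.1 z.2 with hQ
  have hQ0 : 0 ≤ Q := probOf_nonneg hw _
  set C : ℝ := n.choose k * n.choose l with hC
  have hC0 : 0 < C := by
    have := Nat.choose_pos hk
    have := Nat.choose_pos hl
    positivity
  -- Cauchy–Schwarz: `(E X)² ≤ P(X > 0) · E X²` for `X = rectCount k l`.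
  have hcs : (C * q ^ (k * l)) ^ 2
      ≤ Q * ∑ A : Fin n × Fin n → Bool, prodWeight (bernWeight p) A * rectCount k l A ^ 2 := by
    rw [hC, hq, ← sum_weight_mul_rectCount, hQ, probOf_eq_sum_ite]
    refine Finset.sum_sq_le_sum_mul_sum_of_sq_le_mul _ (fun A _ => ?_) (fun A _ => ?_)
      fun A _ => ?_
    · split_ifs
      exacts [hw A, le_rfl]
    · exact mul_nonneg (hw A) (sq_nonneg _)
    · split_ifs with h
      · exact le_of_eq (by ring)
      · push Not at h
        have : rectCount k l A = 0 := Finset.sum_eq_zero fun z hz => if_neg (h z hz)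
        simp [this]
  -- For a fixed rectangle, the others are grouped by overlaps `(i, j)`. There are `(k+1)(l+1)`
  -- groups, each bounded through `B`.
  have hinner : ∀ z ∈ rects n k l, ∑ z' ∈ rects n k l,
      q ^ (z.1 ×ˢ z.2 ∪ z'.1 ×ˢ z'.2).card
        ≤ q ^ (k * l) * q ^ (k * l) * (C * ((k + 1) * (l + 1) * B)) := by
    intro z hz
    rw [Finset.sum_congr rfl fun z' hz' => pow_card_union_rect hq0.ne' hz hz', ← Finset.mul_sum]
    refine mul_le_mul_of_nonneg_left ?_ (by positivity)
    rw [rects, Finset.sum_product]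
    calc ∑ S' ∈ Finset.univ.powersetCard k, ∑ T' ∈ Finset.univ.powersetCard l,
          q⁻¹ ^ ((z.1 ∩ S').card * (z.2 ∩ T').card)
        ≤ ∑ S' ∈ Finset.univ.powersetCard k, (n.choose l * ∑ j ∈ Finset.range (l + 1),
            overlapBound n l j * q⁻¹ ^ ((z.1 ∩ S').card * j)) :=
          Finset.sum_le_sum fun S' _ => sum_overlap_le
            (φ := fun j => q⁻¹ ^ ((z.1 ∩ S').card * j)) (mem_rects.1 hz).2 fun j => by positivity
      _ ≤ n.choose k * ∑ i ∈ Finset.range (k + 1), overlapBound n k i *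
            (n.choose l * ∑ j ∈ Finset.range (l + 1), overlapBound n l j * q⁻¹ ^ (i * j)) :=
          sum_overlap_le (φ := fun i => n.choose l * ∑ j ∈ Finset.range (l + 1),
            overlapBound n l j * q⁻¹ ^ (i * j)) (mem_rects.1 hz).1 fun i =>
              mul_nonneg (Nat.cast_nonneg _) (Finset.sum_nonneg fun j _ =>
                mul_nonneg (overlapBound_nonneg _ _ _) (by positivity))
      _ = C * ∑ i ∈ Finset.range (k + 1), ∑ j ∈ Finset.range (l + 1),
            overlapBound n k i * overlapBound n l j * q⁻¹ ^ (i * j) := by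
          rw [hC, mul_assoc]
          congr 1
          rw [Finset.mul_sum]
          refine Finset.sum_congr rfl fun i _ => ?_
          rw [Finset.mul_sum, Finset.mul_sum, Finset.mul_sum]
          exact Finset.sum_congr rfl fun j _ => by ring
      _ ≤ C * ∑ i ∈ Finset.range (k + 1), ∑ j ∈ Finset.range (l + 1), B := by
          refine mul_le_mul_of_nonneg_left ?_ hC0.le
          refine Finset.sum_le_sum fun i hi => Finset.sum_le_sum fun j hj => ?_
          exact hB i (Nat.lt_succ_iff.1 (Finset.mem_range.1 hi)) j
            (Nat.lt_succ_iff.1 (Finset.mem_range.1 hj))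
      _ = C * ((k + 1) * (l + 1) * B) := by
          simp only [Finset.sum_const, Finset.card_range, nsmul_eq_mul]
          push_cast
          ring
  have hsq : ∑ A : Fin n × Fin n → Bool, prodWeight (bernWeight p) A * rectCount k l A ^ 2
      ≤ (C * q ^ (k * l)) ^ 2 * ((k + 1) * (l + 1) * B) := by
    rw [sum_weight_mul_rectCount_sq]
    refine (Finset.sum_le_sum hinner).trans (le_of_eq ?_)
    rw [Finset.sum_const, card_rects, nsmul_eq_mul, hC]
    push_cast
    ring
  have hpos : 0 < (C * q ^ (k * l)) ^ 2 := by positivity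
  have hfin := hcs.trans (mul_le_mul_of_nonneg_left hsq hQ0)
  refine le_of_mul_le_mul_left ?_ hpos
  linarith

/-- The first moment bound for empty rectangles. -/
lemma probOf_rect_le {n : ℕ} (k l : ℕ) {p : ℝ} (h0 : 0 ≤ p) (h1 : p ≤ 1) :
    probOf (prodWeight (bernWeight p))
      (fun A : Fin n × Fin n → Bool => ∃ z ∈ rects n k l, IsEmptyRect A z.1 z.2)
      ≤ n.choose k * n.choose l * (1 - p) ^ (k * l) := by
  classical
  rw [← sum_weight_mul_rectCount, probOf_eq_sum_ite]
  refine Finset.sum_le_sum fun A _ => ?_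
  have hw := prodWeight_nonneg (bernWeight_nonneg h0 h1) A
  have hnn : ∀ z ∈ rects n k l, (0 : ℝ) ≤ if IsEmptyRect A z.1 z.2 then 1 else 0 := by
    intro z _; split_ifs <;> norm_num
  split_ifs with h
  · obtain ⟨z, hz, hzA⟩ := h
    refine le_mul_of_one_le_right hw ?_
    have := Finset.single_le_sum hnn hz
    rwa [if_pos hzA] at this
  · exact mul_nonneg hw (Finset.sum_nonneg hnn)

/-! ### Exponential estimates for the moments -/

/-- The exponential rate of `overlapBound` for sets of density `a` overlapping with density `x`. -/
noncomputable def overlapRate (a x : ℝ) : ℝ := min 0 (x * Real.log (Real.exp 1 * a ^ 2 / x))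

lemma overlapBound_le_exp {n k : ℕ} (hn : 0 < n) {a : ℝ} (ha : 0 < a) (hk : (k : ℝ) ≤ a * n)
    (i : ℕ) : overlapBound n k i ≤ Real.exp (n * overlapRate a (i / n)) := by
  have hn' : (0 : ℝ) < n := by exact_mod_cast hn
  rw [overlapRate, mul_min_of_nonneg _ _ hn'.le, mul_zero, overlapBound]
  rcases Nat.eq_zero_or_pos i with rfl | hi
  · simp
  have hi' : (0 : ℝ) < i := by exact_mod_cast hi
  rw [Real.exp_monotone.map_min, Real.exp_zero]
  refine min_le_min_left 1 ?_
  have hf : (0 : ℝ) < i.factorial := by exact_mod_cast i.factorial_pos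
  have harg : 0 < Real.exp 1 * a ^ 2 / (i / n) := by positivity
  have hexp : Real.exp (n * (i / n * Real.log (Real.exp 1 * a ^ 2 / (i / n))))
      = (Real.exp 1 * a ^ 2 / (i / n)) ^ i := by
    rw [← Real.rpow_natCast _ i, Real.rpow_def_of_pos harg]
    congr 1
    field_simp
  rw [hexp]
  calc (k.choose i : ℝ) * ((k : ℝ) / n) ^ i
      ≤ (k : ℝ) ^ i / i.factorial * ((k : ℝ) / n) ^ i :=
        mul_le_mul_of_nonneg_right (Nat.choose_le_pow_div i k) (by positivity)
    _ ≤ (a * n) ^ i / i.factorial * (a * n / n) ^ i := by gcongr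
    _ = (a ^ 2 / (i / n)) ^ i * ((i : ℝ) ^ i / i.factorial) := by
        rw [div_mul_eq_mul_div, mul_div_assoc', ← mul_pow, ← mul_pow]
        congr 2
        field_simp
    _ ≤ (a ^ 2 / (i / n)) ^ i * Real.exp i :=
        mul_le_mul_of_nonneg_left (Real.pow_div_factorial_le_exp _ hi'.le i) (by positivity)
    _ = (Real.exp 1 * a ^ 2 / (i / n)) ^ i := by
        rw [← Real.exp_one_pow, ← mul_pow]; congr 1; ring

lemma overlapRate_nonpos (a x : ℝ) : overlapRate a x ≤ 0 := min_le_left _ _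

/-- Once the overlap density `x` exceeds the typical scale `a²` by a factor `exp (c + 1)`, the
logarithm is below `-c`. It is used with `c = 1` and with `c = Λ`. -/
lemma overlapRate_le {a x c : ℝ} (ha : 0 < a) (hx : 0 ≤ x)
    (h : Real.exp c * (Real.exp 1 * a ^ 2) < x) : overlapRate a x ≤ -c * x := by
  have hx0 : 0 < x := lt_of_le_of_lt (by positivity) h
  refine (min_le_right _ _).trans ?_
  rw [mul_comm (-c)]
  refine mul_le_mul_of_nonneg_left ?_ hx
  rw [Real.log_le_iff_le_exp (by positivity), div_le_iff₀ hx0, Real.exp_neg,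
    inv_mul_eq_div, le_div_iff₀ (Real.exp_pos _)]
  linarith

/-- Below the threshold no pair of overlap densities contributes more than the typical one. -/
lemma overlapRate_add_le {a b D Λ : ℝ} (ha : 0 < a) (hb : 0 < b) (hD : 0 < D) (hΛ : 1 ≤ Λ)
    (h1 : Real.exp Λ * (Real.exp 1 * a ^ 2) * D < 1)
    (h2 : Real.exp Λ * (Real.exp 1 * b ^ 2) * D < 1) (h3 : D * (a * b) ≤ Λ * (a + b))
    {x y : ℝ} (hx : 0 ≤ x) (hxa : x ≤ a) (hy : 0 ≤ y) (hyb : y ≤ b) :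
    overlapRate a x + overlapRate b y + D * x * y
      ≤ D * (Real.exp 1 * (Real.exp 1 * a ^ 2)) * (Real.exp 1 * (Real.exp 1 * b ^ 2)) := by
  have hE : Real.exp 1 ≤ Real.exp Λ := Real.exp_le_exp.2 hΛ
  have hR : 0 ≤ D * (Real.exp 1 * (Real.exp 1 * a ^ 2)) * (Real.exp 1 * (Real.exp 1 * b ^ 2)) := by
    positivity
  have h1' : Real.exp 1 * (Real.exp 1 * a ^ 2) * D ≤ 1 :=
    le_trans (by gcongr) h1.le
  have h2' : Real.exp 1 * (Real.exp 1 * b ^ 2) * D ≤ 1 :=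
    le_trans (by gcongr) h2.le
  have hax := overlapRate_nonpos a x
  have hby := overlapRate_nonpos b y
  -- If both overlaps are at the typical scale, the gain `Dxy` is itself within the bound. In every
  -- other case the overlap costs outweigh the gain and the sum is nonpositive.
  rcases le_or_gt x (Real.exp 1 * (Real.exp 1 * a ^ 2)) with cx | cx
  · rcases le_or_gt y (Real.exp 1 * (Real.exp 1 * b ^ 2)) with cy | cy
    · have : D * x * y
          ≤ D * (Real.exp 1 * (Real.exp 1 * a ^ 2)) * (Real.exp 1 * (Real.exp 1 * b ^ 2)) := by
        gcongr
      linarith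
    · have hr := overlapRate_le hb hy cy
      have : x * D * y ≤ 1 * y :=
        mul_le_mul_of_nonneg_right ((mul_le_mul_of_nonneg_right cx hD.le).trans h1') hy
      linarith
  · have hrx := overlapRate_le ha hx cx
    rcases le_or_gt y (Real.exp 1 * (Real.exp 1 * b ^ 2)) with cy | cy
    · have : y * D * x ≤ 1 * x :=
        mul_le_mul_of_nonneg_right ((mul_le_mul_of_nonneg_right cy hD.le).trans h2') hx
      linarith
    · have hry := overlapRate_le hb hy cy
      rcases le_or_gt (x * D) 1 with dx | dx
      · have : x * D * y ≤ 1 * y := mul_le_mul_of_nonneg_right dx hy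
        linarith
      rcases le_or_gt (y * D) 1 with dy | dy
      · have : y * D * x ≤ 1 * x := mul_le_mul_of_nonneg_right dy hx
        linarith
      -- Both overlaps now exceed `1/D`, hence lie far enough above the typical scale to cost `Λ`
      -- per unit.
      have ex := overlapRate_le (c := Λ) ha hx (lt_of_mul_lt_mul_right (h1.trans dx) hD.le)
      have ey := overlapRate_le (c := Λ) hb hy (lt_of_mul_lt_mul_right (h2.trans dy) hD.le)
      -- `xy/(x+y)` increases in each variable, so the worst case is full overlap `(a, b)`, which
      -- `h3` controls.
      have hxy : x * y * (a + b) ≤ a * b * (x + y) := by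
        have e1 : a * x * y ≤ a * x * b := mul_le_mul_of_nonneg_left hyb (by positivity)
        have e2 : b * y * x ≤ b * y * a := mul_le_mul_of_nonneg_left hxa (by positivity)
        linarith
      have hDxy : D * x * y ≤ Λ * (x + y) := by
        have hab : 0 < a + b := by positivity
        refine le_of_mul_le_mul_right ?_ hab
        calc D * x * y * (a + b) = D * (x * y * (a + b)) := by ring
          _ ≤ D * (a * b * (x + y)) := mul_le_mul_of_nonneg_left hxy hD.le
          _ = D * (a * b) * (x + y) := by ring
          _ ≤ Λ * (a + b) * (x + y) := mul_le_mul_of_nonneg_right h3 (by positivity)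
          _ = Λ * (x + y) * (a + b) := by ring
      linarith

/-- `C(n,k) a^k ≤ (na)^k / k! ≤ exp (na)`, and `a^(-k) ≤ a^(-an)`. -/
lemma choose_le_exp {n k : ℕ} {a : ℝ} (ha : 0 < a) (ha1 : a ≤ 1) (hk : (k : ℝ) ≤ a * n) :
    (n.choose k : ℝ) ≤ Real.exp (n * (a + a * Real.log (1 / a))) := by
  have h1 : (n.choose k : ℝ) * a ^ k ≤ Real.exp (n * a) := by
    refine le_trans ?_ (Real.pow_div_factorial_le_exp _ (by positivity) k)
    rw [mul_pow, mul_div_right_comm]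
    exact mul_le_mul_of_nonneg_right (Nat.choose_le_pow_div k n) (by positivity)
  have h2 : (a ^ k)⁻¹ ≤ Real.exp (n * (a * Real.log (1 / a))) := by
    have : (a ^ k)⁻¹ = Real.exp (k * Real.log (1 / a)) := by
      rw [one_div, Real.log_inv, mul_neg, Real.exp_neg, mul_comm, ← Real.rpow_def_of_pos ha,
        Real.rpow_natCast]
    rw [this]
    refine Real.exp_le_exp.2 ?_
    rw [← mul_assoc, mul_comm (n : ℝ)]
    exact mul_le_mul_of_nonneg_right hk (Real.log_nonneg (by rw [le_div_iff₀ ha]; linarith))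
  calc (n.choose k : ℝ) = n.choose k * a ^ k * (a ^ k)⁻¹ := by
        rw [mul_assoc, mul_inv_cancel₀ (by positivity), mul_one]
    _ ≤ Real.exp (n * a) * Real.exp (n * (a * Real.log (1 / a))) :=
        mul_le_mul h1 h2 (by positivity) (Real.exp_pos _).le
    _ = _ := by rw [← Real.exp_add]; ring_nf

/-! ### The edge probability -/

lemma edgeProb_eq {n : ℕ} {d : ℝ} (hd : 0 ≤ d) (hdn : d ≤ n) :
    (edgeProb n d : ℝ) = d / n := by
  rw [edgeProb, Set.coe_projIcc, min_eq_right (div_le_one_of_le₀ hdn (Nat.cast_nonneg n)),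
    max_eq_right (by positivity)]

lemma eventually_edgeProb {d : ℝ} (hd : 0 ≤ d) : ∀ᶠ n : ℕ in atTop, (edgeProb n d : ℝ) = d / n := by
  filter_upwards [tendsto_natCast_atTop_atTop.eventually_ge_atTop d] with n hn
  exact edgeProb_eq hd hn

/-- `-log (1-p) ≤ p/(1-p)`, and with `p = d/n` the right side is at most `D/n` as soon as `1 - p ≥
d/D`. -/
lemma eventually_inv_one_sub_le {d D : ℝ} (hd : 0 < d) (hD : d < D) :
    ∀ᶠ n : ℕ in atTop, d / n < 1 ∧ (1 - d / n)⁻¹ ≤ Real.exp (D / n) := by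
  have hr : 0 < 1 - d / D := by rw [sub_pos, div_lt_one (hd.trans hD)]; exact hD
  have ht : Tendsto (fun n : ℕ => d / (n : ℝ)) atTop (𝓝 0) :=
    tendsto_const_nhds.div_atTop tendsto_natCast_atTop_atTop
  filter_upwards [ht.eventually_lt_const hr, eventually_gt_atTop 0] with n hn hn0
  have hn' : (0 : ℝ) < n := by exact_mod_cast hn0
  have hD0 := hd.trans hD
  have hdD : 0 < d / D := by positivity
  have hq : d / D ≤ 1 - d / n := by linarith
  have hq0 : 0 < 1 - d / n := hdD.trans_le hq
  refine ⟨by linarith, ?_⟩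
  rw [← Real.log_le_iff_le_exp (by positivity), Real.log_inv]
  have h1 := Real.one_sub_inv_le_log_of_pos hq0
  have h2 : (1 - d / n)⁻¹ - 1 ≤ D / n := by
    have : (1 - d / n)⁻¹ - 1 = d / n / (1 - d / n) := by
      rw [eq_div_iff hq0.ne', sub_mul, inv_mul_cancel₀ hq0.ne']; ring
    rw [this, div_le_iff₀ hq0]
    calc d / n = D / n * (d / D) := by field_simp
      _ ≤ _ := mul_le_mul_of_nonneg_left hq (by positivity)
  linarith

/-! ### Empty rectangles above the threshold -/

/-- The event that there is an empty `S × T` with `|S| ≥ s` and `|T| ≥ t`. -/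
def HasEmptyRect {n : ℕ} (A : Fin n × Fin n → Bool) (s t : ℝ) : Prop :=
  ∃ S T : Finset (Fin n), IsEmptyRect A S T ∧ s ≤ S.card ∧ t ≤ T.card

lemma IsEmptyRect.mono {n : ℕ} {A : Fin n × Fin n → Bool} {S S' T T' : Finset (Fin n)}
    (h : IsEmptyRect A S T) (hS : S' ⊆ S) (hT : T' ⊆ T) : IsEmptyRect A S' T' :=
  fun e he => h e (Finset.product_subset_product hS hT he)

lemma HasEmptyRect.exists_rects {n : ℕ} {A : Fin n × Fin n → Bool} {s t : ℝ}
    (h : HasEmptyRect A s t) : ∃ z ∈ rects n ⌈s⌉₊ ⌈t⌉₊, IsEmptyRect A z.1 z.2 := by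
  obtain ⟨S, T, hE, hS, hT⟩ := h
  obtain ⟨S', hS', hSc⟩ := Finset.exists_subset_card_eq (Nat.ceil_le.2 hS)
  obtain ⟨T', hT', hTc⟩ := Finset.exists_subset_card_eq (Nat.ceil_le.2 hT)
  exact ⟨(S', T'), mem_rects.2 ⟨hSc, hTc⟩, hE.mono hS' hT'⟩

lemma eventually_ceil_sub_one_le {a : ℝ} (ha : 0 < a) :
    ∀ᶠ n : ℕ in atTop, 0 ≤ a * n - 1 ∧ ((⌈a * n - 1⌉₊ : ℕ) : ℝ) ≤ a * n := by
  have ht : Tendsto (fun n : ℕ => a * (n : ℝ)) atTop atTop :=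
    tendsto_natCast_atTop_atTop.const_mul_atTop ha
  filter_upwards [ht.eventually_ge_atTop 1] with n hn
  have h0 : 0 ≤ a * (n : ℝ) - 1 := by linarith
  have := Nat.ceil_lt_add_one h0
  exact ⟨h0, by linarith⟩

/-- First moment. The `-1` in each side, needed because balance is only up to one vertex, costs just
the factor `exp (d(a+b))`, constant in `n`. -/
lemma tendsto_hasEmptyRect_zero {a b d : ℝ} (hd : 0 < d) (ha : 0 < a) (ha1 : a ≤ 1) (hb : 0 < b)
    (hb1 : b ≤ 1)
    (hneg : a + a * Real.log (1 / a) + (b + b * Real.log (1 / b)) - d * (a * b) < 0) :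
    Tendsto (fun n : ℕ => (bipLaw n d).real {A | HasEmptyRect A (a * n - 1) (b * n - 1)})
      atTop (𝓝 0) := by
  classical
  set c := a + a * Real.log (1 / a) + (b + b * Real.log (1 / b)) - d * (a * b) with hc
  have hlim : Tendsto (fun n : ℕ => Real.exp (n * c + d * (a + b))) atTop (𝓝 0) := by
    refine Real.tendsto_exp_atBot.comp ?_
    exact tendsto_atBot_add_const_right _ _
      (tendsto_natCast_atTop_atTop.atTop_mul_const_of_neg hneg)
  refine squeeze_zero' (Eventually.of_forall fun n => measureReal_nonneg) ?_ hlim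
  filter_upwards [eventually_edgeProb hd.le, eventually_ceil_sub_one_le ha,
    eventually_ceil_sub_one_le hb, eventually_gt_atTop 0] with n hp hka hkb hn
  have hn' : (0 : ℝ) < n := by exact_mod_cast hn
  set k := ⌈a * (n : ℝ) - 1⌉₊
  set l := ⌈b * (n : ℝ) - 1⌉₊
  have hp0 : 0 ≤ (edgeProb n d : ℝ) := (edgeProb n d).2.1
  have hp1 : (edgeProb n d : ℝ) ≤ 1 := (edgeProb n d).2.2
  have hmono : (bipLaw n d).real {A | HasEmptyRect A (a * n - 1) (b * n - 1)}
      ≤ (bipLaw n d).real {A | ∃ z ∈ rects n k l, IsEmptyRect A z.1 z.2} :=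
    measureReal_mono fun A hA => HasEmptyRect.exists_rects hA
  refine hmono.trans ?_
  rw [bipLaw_real_eq]
  refine (probOf_rect_le k l hp0 hp1).trans ?_
  have hpow : (1 - (edgeProb n d : ℝ)) ^ (k * l)
      ≤ Real.exp (-(n * (d * (a * b)) - d * (a + b))) := by
    calc (1 - (edgeProb n d : ℝ)) ^ (k * l) ≤ Real.exp (-(edgeProb n d : ℝ)) ^ (k * l) :=
          pow_le_pow_left₀ (by linarith) (Real.one_sub_le_exp_neg _) _
      _ = Real.exp (-(d / n * (k * l))) := by
          rw [← Real.exp_nat_mul, hp]; push_cast; ring_nf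
      _ ≤ _ := by
          refine Real.exp_le_exp.2 (neg_le_neg ?_)
          have h1 : a * (n : ℝ) - 1 ≤ k := Nat.le_ceil _
          have h2 : b * (n : ℝ) - 1 ≤ l := Nat.le_ceil _
          have h3 : (a * (n : ℝ) - 1) * (b * n - 1) ≤ k * l :=
            mul_le_mul h1 h2 hkb.1 (Nat.cast_nonneg _)
          calc (n : ℝ) * (d * (a * b)) - d * (a + b)
              = d / n * ((a * n - 1) * (b * n - 1) - 1) := by field_simp; ring
            _ ≤ d / n * (k * l) := mul_le_mul_of_nonneg_left (by linarith) (by positivity)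
  calc (n.choose k : ℝ) * n.choose l * (1 - (edgeProb n d : ℝ)) ^ (k * l)
      ≤ Real.exp (n * (a + a * Real.log (1 / a))) * Real.exp (n * (b + b * Real.log (1 / b)))
        * Real.exp (-(n * (d * (a * b)) - d * (a + b))) := by
        refine mul_le_mul (mul_le_mul (choose_le_exp ha ha1 hka.2) (choose_le_exp hb hb1 hkb.2)
          (by positivity) (by positivity)) hpow (pow_nonneg (by linarith) _) (by positivity)
    _ = Real.exp (n * c + d * (a + b)) := by
        rw [← Real.exp_add, ← Real.exp_add, hc]; ring_nf

/-! ### Empty rectangles below the threshold -/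

/-- The common non-neighbours of `T`, for the graph given by its rows. -/
def nonNbrs {n : ℕ} (x : Fin n → Fin n → Bool) (T : Finset (Fin n)) : Finset (Fin n) :=
  Finset.univ.filter fun i => ∀ j ∈ T, x i j = false

/-- The largest number of common non-neighbours of an `l`-set. -/
def maxNonNbrs {n : ℕ} (l : ℕ) (x : Fin n → Fin n → Bool) : ℕ :=
  (Finset.univ.powersetCard l).sup fun T => (nonNbrs x T).card

/-- Row `i` decides only whether `i` itself is a common non-neighbour. -/
lemma maxNonNbrs_update_le {n : ℕ} (l : ℕ) (x : Fin n → Fin n → Bool) (i : Fin n)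
    (r : Fin n → Bool) : maxNonNbrs l (Function.update x i r) ≤ maxNonNbrs l x + 1 := by
  refine Finset.sup_le fun T hT => ?_
  have hsub : nonNbrs (Function.update x i r) T ⊆ insert i (nonNbrs x T) := by
    intro m hm
    rcases eq_or_ne m i with rfl | hmi
    · exact Finset.mem_insert_self _ _
    · refine Finset.mem_insert_of_mem ?_
      simpa [nonNbrs, Function.update_of_ne hmi] using hm
  refine (Finset.card_le_card hsub).trans ((Finset.card_insert_le _ _).trans ?_)
  exact Nat.add_le_add_right
    (Finset.le_sup (f := fun T => (nonNbrs x T).card) hT) 1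

lemma abs_maxNonNbrs_update_sub_le {n : ℕ} (l : ℕ) (x : Fin n → Fin n → Bool) (i : Fin n)
    (r : Fin n → Bool) :
    |(maxNonNbrs l (Function.update x i r) : ℝ) - maxNonNbrs l x| ≤ 1 := by
  have h1 := maxNonNbrs_update_le l x i r
  -- The reverse inequality comes from restoring the original row.
  have h2 := maxNonNbrs_update_le l (Function.update x i r) i (x i)
  rw [Function.update_idem, Function.update_eq_self] at h2
  have h1' : (maxNonNbrs l (Function.update x i r) : ℝ) ≤ maxNonNbrs l x + 1 := by
    exact_mod_cast h1
  have h2' : (maxNonNbrs l x : ℝ) ≤ maxNonNbrs l (Function.update x i r) + 1 := by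
    exact_mod_cast h2
  rw [abs_le]
  constructor <;> linarith

lemma exists_isEmptyRect_maxNonNbrs {n l : ℕ} (hl : l ≤ n) (x : Fin n → Fin n → Bool) :
    ∃ S T : Finset (Fin n), IsEmptyRect (Function.uncurry x) S T ∧ S.card = maxNonNbrs l x ∧
      T.card = l := by
  have hne : (Finset.univ.powersetCard l : Finset (Finset (Fin n))).Nonempty :=
    Finset.powersetCard_nonempty.2 (by simpa using hl)
  obtain ⟨T, hT, h⟩ := Finset.exists_mem_eq_sup _ hne fun T => (nonNbrs x T).card
  refine ⟨nonNbrs x T, T, ?_, h.symm, (Finset.mem_powersetCard.1 hT).2⟩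
  rintro ⟨i, j⟩ he
  obtain ⟨hi, hj⟩ := Finset.mem_product.1 he
  exact (Finset.mem_filter.1 hi).2 j hj

lemma le_maxNonNbrs {n k l : ℕ} {x : Fin n → Fin n → Bool}
    (h : ∃ z ∈ rects n k l, IsEmptyRect (Function.uncurry x) z.1 z.2) : k ≤ maxNonNbrs l x := by
  obtain ⟨⟨S, T⟩, hz, hE⟩ := h
  obtain ⟨hS, hT⟩ := mem_rects.1 hz
  have hsub : S ⊆ nonNbrs x T := fun i hi =>
    Finset.mem_filter.2 ⟨Finset.mem_univ i, fun j hj => hE (i, j) (Finset.mem_product.2 ⟨hi, hj⟩)⟩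
  refine le_trans (hS.symm.le.trans (Finset.card_le_card hsub)) ?_
  exact Finset.le_sup (f := fun T => (nonNbrs x T).card)
    (Finset.mem_powersetCard.2 ⟨Finset.subset_univ T, hT⟩)

/-- Exposing whole rows leaves `n` independent coordinates; with `n²` single pairs, deviations of
order `n` would not be exponentially unlikely. -/
lemma probOf_rows {n : ℕ} (p : ℝ) (P : (Fin n × Fin n → Bool) → Prop) :
    probOf (prodWeight (bernWeight p)) P =
      probOf (prodWeight (prodWeight (bernWeight p)))
        fun x : Fin n → Fin n → Bool => P (Function.uncurry x) := by
  classical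
  have h := sum_prodWeight_rows p fun A => if P A then (1 : ℝ) else 0
  simp only [mul_ite, mul_one, mul_zero] at h
  rw [probOf_eq_sum_ite, probOf_eq_sum_ite, h]

/-- Concentration: a `k × l` empty rectangle, even if it exists only with exponentially small
probability, forces slightly smaller ones to exist with high probability. -/
lemma probOf_rect_mul_probOf_not_le {n k l : ℕ} (hl : l ≤ n) {p : ℝ} (h0 : 0 ≤ p) (h1 : p ≤ 1)
    {τ : ℝ} (hτ : 0 < τ) (hτ4 : τ ≤ 4) :
    probOf (prodWeight (bernWeight p))
        (fun A : Fin n × Fin n → Bool => ∃ z ∈ rects n k l, IsEmptyRect A z.1 z.2) *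
      probOf (prodWeight (bernWeight p))
        (fun A : Fin n × Fin n → Bool => ¬ HasEmptyRect A (k - τ * n) l)
      ≤ Real.exp (-(n * (τ ^ 2 / 8))) := by
  have hb := bernWeight_nonneg h0 h1
  have hW : ∀ r : Fin n → Bool, 0 ≤ prodWeight (bernWeight p) r := prodWeight_nonneg hb
  have hW1 : ∑ r : Fin n → Bool, prodWeight (bernWeight p) r = 1 :=
    sum_prodWeight (sum_bernWeight p)
  have hWW := fun x : Fin n → Fin n → Bool => prodWeight_nonneg hW x
  rw [probOf_rows, probOf_rows]
  -- `t = τ/4` minimises `2nt² - tτn`; `τ ≤ 4` keeps `t ≤ 1`.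
  have hmain := tail_mul_tail_le hW hW1 (t := τ / 4) (by positivity) (by linarith) n
    (fun x => (maxNonNbrs l x : ℝ)) (abs_maxNonNbrs_update_sub_le l) k (k - τ * n)
  have hexp : 2 * (n : ℝ) * (τ / 4) ^ 2 - τ / 4 * (k - (k - τ * n)) = -(n * (τ ^ 2 / 8)) := by ring
  rw [hexp] at hmain
  refine le_trans (mul_le_mul ?_ ?_ (probOf_nonneg hWW _) (probOf_nonneg hWW _)) hmain
  · refine probOf_mono hWW fun x hx => ?_
    exact Nat.cast_le.2 (le_maxNonNbrs hx)
  · refine probOf_mono hWW fun x hx => ?_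
    by_contra hlt
    push Not at hlt
    obtain ⟨S, T, hE, hS, hT⟩ := exists_isEmptyRect_maxNonNbrs hl x
    exact hx ⟨S, T, hE, by rw [hS]; exact hlt.le, by rw [hT]⟩

lemma tendsto_poly_mul_exp_neg {c : ℝ} (hc : 0 < c) :
    Tendsto (fun n : ℕ => ((n : ℝ) + 1) * (n + 1) * Real.exp (-(n * c))) atTop (𝓝 0) := by
  have h0 : ∀ m : ℕ, Tendsto (fun n : ℕ => (n : ℝ) ^ m * Real.exp (-c * n)) atTop (𝓝 0) := by
    intro m
    have h := (tendsto_rpow_mul_exp_neg_mul_atTop_nhds_zero (m : ℝ) c hc).comp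
      (tendsto_natCast_atTop_atTop (R := ℝ))
    simpa [Function.comp_def] using h
  have := ((h0 2).add ((h0 1).const_mul 2)).add (h0 0)
  simp only [mul_zero, add_zero] at this
  refine this.congr fun n => ?_
  rw [show -c * (n : ℝ) = -(n * c) by ring]
  ring

lemma tendsto_hasEmptyRect_one {a b d D Λ τ : ℝ} (hd : 0 < d) (hD : d < D) (ha : 0 < a)
    (ha1 : a ≤ 1) (hb : 0 < b) (hb1 : b ≤ 1) (hΛ : 1 ≤ Λ)
    (h1 : Real.exp Λ * (Real.exp 1 * a ^ 2) * D < 1)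
    (h2 : Real.exp Λ * (Real.exp 1 * b ^ 2) * D < 1) (h3 : D * (a * b) ≤ Λ * (a + b))
    (hτ : 0 < τ) (hτ4 : τ ≤ 4)
    (h4 : D * (Real.exp 1 * (Real.exp 1 * a ^ 2)) * (Real.exp 1 * (Real.exp 1 * b ^ 2))
      < τ ^ 2 / 8) :
    Tendsto (fun n : ℕ => (bipLaw n d).real {A | HasEmptyRect A ((a - τ) * n - 1) (b * n - 1)})
      atTop (𝓝 1) := by
  classical
  set δ := D * (Real.exp 1 * (Real.exp 1 * a ^ 2)) * (Real.exp 1 * (Real.exp 1 * b ^ 2)) with hδ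
  have hlim := tendsto_poly_mul_exp_neg (sub_pos.2 h4)
  have hlim' : Tendsto (fun n : ℕ =>
      1 - ((n : ℝ) + 1) * (n + 1) * Real.exp (-(n * (τ ^ 2 / 8 - δ)))) atTop (𝓝 1) := by
    simpa using hlim.const_sub 1
  refine tendsto_of_tendsto_of_tendsto_of_le_of_le' hlim' tendsto_const_nhds ?_
    (Eventually.of_forall fun n => measureReal_le_one)
  filter_upwards [eventually_edgeProb hd.le, eventually_inv_one_sub_le hd hD,
    eventually_gt_atTop 0] with n hp hq hn
  have hn' : (0 : ℝ) < n := by exact_mod_cast hn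
  set k := ⌊a * (n : ℝ)⌋₊
  set l := ⌊b * (n : ℝ)⌋₊
  have hka : (k : ℝ) ≤ a * n := Nat.floor_le (by positivity)
  have hlb : (l : ℝ) ≤ b * n := Nat.floor_le (by positivity)
  have hka' : a * n - 1 ≤ k := by linarith [Nat.lt_floor_add_one (a * (n : ℝ))]
  have hlb' : b * n - 1 ≤ l := by linarith [Nat.lt_floor_add_one (b * (n : ℝ))]
  have hkn : k ≤ n := by
    have : (k : ℝ) ≤ n := hka.trans (mul_le_of_le_one_left hn'.le ha1)
    exact_mod_cast this
  have hln : l ≤ n := by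
    have : (l : ℝ) ≤ n := hlb.trans (mul_le_of_le_one_left hn'.le hb1)
    exact_mod_cast this
  have hp0 : 0 ≤ (edgeProb n d : ℝ) := (edgeProb n d).2.1
  have hp1 : (edgeProb n d : ℝ) < 1 := by rw [hp]; exact hq.1
  have hB : ∀ i ≤ k, ∀ j ≤ l, overlapBound n k i * overlapBound n l j
      * (1 - (edgeProb n d : ℝ))⁻¹ ^ (i * j) ≤ Real.exp (n * δ) := by
    intro i hi j hj
    have hi' : (i : ℝ) / n ≤ a := by
      rw [div_le_iff₀ hn']; exact le_trans (by exact_mod_cast hi) hka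
    have hj' : (j : ℝ) / n ≤ b := by
      rw [div_le_iff₀ hn']; exact le_trans (by exact_mod_cast hj) hlb
    have hrate := overlapRate_add_le ha hb (hd.trans hD) hΛ h1 h2 h3
      (by positivity : (0 : ℝ) ≤ i / n) hi' (by positivity : (0 : ℝ) ≤ j / n) hj'
    have hqpow : (1 - (edgeProb n d : ℝ))⁻¹ ^ (i * j) ≤ Real.exp (n * (D * (i / n) * (j / n))) := by
      have hq0 : 0 ≤ (1 - (edgeProb n d : ℝ))⁻¹ := inv_nonneg.2 (by linarith)
      rw [hp] at hq0 ⊢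
      refine (pow_le_pow_left₀ hq0 hq.2 _).trans_eq ?_
      rw [← Real.exp_nat_mul]
      congr 1
      push_cast
      field_simp
    calc _ ≤ Real.exp (n * overlapRate a (i / n)) * Real.exp (n * overlapRate b (j / n))
          * Real.exp (n * (D * (i / n) * (j / n))) := by
          refine mul_le_mul (mul_le_mul (overlapBound_le_exp hn ha hka i)
            (overlapBound_le_exp hn hb hlb j) (overlapBound_nonneg _ _ _) (by positivity)) hqpow
            (pow_nonneg (inv_nonneg.2 (by linarith)) _) (by positivity)
      _ = Real.exp (n * (overlapRate a (i / n) + overlapRate b (j / n)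
            + D * (i / n) * (j / n))) := by
          rw [← Real.exp_add, ← Real.exp_add]; ring_nf
      _ ≤ _ := Real.exp_le_exp.2 (mul_le_mul_of_nonneg_left hrate hn'.le)
  have hsecond := one_le_mul_probOf_rect hkn hln hp0 hp1 hB
  have hconc := probOf_rect_mul_probOf_not_le (k := k) hln hp0 hp1.le hτ hτ4
  rw [← bipLaw_real_eq, ← bipLaw_real_eq] at hconc
  rw [← bipLaw_real_eq] at hsecond
  set Q := (bipLaw n d).real {A | ∃ z ∈ rects n k l, IsEmptyRect A z.1 z.2}
  set R := (bipLaw n d).real {A | ¬ HasEmptyRect A ((k : ℝ) - τ * n) l} with hR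
  have hR0 : 0 ≤ R := measureReal_nonneg
  have hkr : (k : ℝ) ≤ n := by exact_mod_cast hkn
  have hlr : (l : ℝ) ≤ n := by exact_mod_cast hln
  -- The second moment bounds `1` by a polynomial times `exp (nδ) Q`, concentration bounds `QR`, and
  -- `δ < τ²/8` makes `R` vanish.
  have hRle : R ≤ ((n : ℝ) + 1) * (n + 1) * Real.exp (-(n * (τ ^ 2 / 8 - δ))) := by
    calc R = 1 * R := (one_mul R).symm
      _ ≤ (k + 1) * (l + 1) * Real.exp (n * δ) * Q * R := mul_le_mul_of_nonneg_right hsecond hR0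
      _ = (k + 1) * (l + 1) * Real.exp (n * δ) * (Q * R) := by ring
      _ ≤ ((n : ℝ) + 1) * (n + 1) * Real.exp (n * δ) * Real.exp (-(n * (τ ^ 2 / 8))) := by
          refine mul_le_mul (by gcongr) hconc (mul_nonneg measureReal_nonneg hR0) (by positivity)
      _ = _ := by
          rw [mul_assoc _ (Real.exp _), ← Real.exp_add]; ring_nf
  have hcompl : (bipLaw n d).real {A | HasEmptyRect A ((k : ℝ) - τ * n) l} = 1 - R := by
    have := measureReal_compl (μ := bipLaw n d)
      (s := {A | HasEmptyRect A ((k : ℝ) - τ * n) l}) (MeasurableSet.of_discrete)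
    rw [Set.compl_ofPred] at this
    rw [hR, this, probReal_univ]
    ring
  have hmono : (bipLaw n d).real {A | HasEmptyRect A ((k : ℝ) - τ * n) l}
      ≤ (bipLaw n d).real {A | HasEmptyRect A ((a - τ) * n - 1) (b * n - 1)} := by
    refine measureReal_mono fun A hA => ?_
    obtain ⟨S, T, hE, hS, hT⟩ := hA
    exact ⟨S, T, hE, le_trans (by linarith) hS, hlb'.trans hT⟩
  linarith

/-! ### Independent sets and empty rectangles -/

lemma isIndepSet_bipGraph_iff {n : ℕ} {A : Fin n × Fin n → Bool} {I : Finset (Vertex n)} :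
    (bipGraph A).IsIndepSet (I : Set (Vertex n)) ↔ IsEmptyRect A I.toLeft I.toRight := by
  constructor
  · rintro h ⟨i, j⟩ he
    obtain ⟨hi, hj⟩ := Finset.mem_product.1 he
    have := h (Finset.mem_coe.2 (Finset.mem_toLeft.1 hi)) (Finset.mem_coe.2 (Finset.mem_toRight.1 hj))
      Sum.inl_ne_inr
    simpa [bipGraph] using this
  · rintro h (i | i) hi (j | j) hj _ hadj
    · exact hadj
    · have := h (i, j) (Finset.mem_product.2 ⟨Finset.mem_toLeft.2 hi, Finset.mem_toRight.2 hj⟩)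
      simp [bipGraph, this] at hadj
    · have := h (j, i) (Finset.mem_product.2 ⟨Finset.mem_toLeft.2 hj, Finset.mem_toRight.2 hi⟩)
      simp [bipGraph, this] at hadj
    · exact hadj

lemma hasEmptyRect_of_le_maxGammaBalanced {n : ℕ} {A : Fin n × Fin n → Bool} {γ s : ℝ}
    (hγ : 0 ≤ γ) (hγ1 : γ ≤ 1) (h : s ≤ maxGammaBalanced γ (bipGraph A)) :
    HasEmptyRect A (γ * s - 1) ((1 - γ) * s - 1) := by
  classical
  have hempty : (∅ : Finset (Vertex n)) ∈
      Finset.univ.filter (IsGammaBalancedIndep γ (bipGraph A)) := by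
    refine Finset.mem_filter.2 ⟨Finset.mem_univ _, ?_, ?_⟩
    · simp [SimpleGraph.IsIndepSet]
    · have : (∅ : Finset (Vertex n)).toLeft = ∅ := by ext; simp
      simp [this]
  obtain ⟨I, hI, hmax⟩ := Finset.exists_mem_eq_sup _ ⟨_, hempty⟩ Finset.card
  obtain ⟨hind, hbal⟩ := (Finset.mem_filter.1 hI).2
  have hs : s ≤ I.card := by
    rw [maxGammaBalanced] at h
    rw [← hmax]
    convert! h
  have hcard : (I.toLeft.card : ℝ) + I.toRight.card = I.card := by
    exact_mod_cast Finset.card_toLeft_add_card_toRight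
  rw [abs_lt] at hbal
  refine ⟨I.toLeft, I.toRight, isIndepSet_bipGraph_iff.1 hind, ?_, ?_⟩
  · linarith [mul_le_mul_of_nonneg_left hs hγ]
  · linarith [mul_le_mul_of_nonneg_left hs (sub_nonneg.2 hγ1)]

lemma IsEmptyRect.isIndepSet_disjSum {n : ℕ} {A : Fin n × Fin n → Bool} {S T : Finset (Fin n)}
    (h : IsEmptyRect A S T) : (bipGraph A).IsIndepSet (S.disjSum T : Set (Vertex n)) := by
  rw [isIndepSet_bipGraph_iff, Finset.toLeft_disjSum, Finset.toRight_disjSum]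
  exact h

/-- Keep `⌊γm⌋` vertices of `S` and `m - ⌊γm⌋` of `T`; rounding down on the left is why only the
right side needs the extra `1`. -/
lemma HasEmptyRect.le_maxGammaBalanced {n : ℕ} {A : Fin n × Fin n → Bool} {γ s t : ℝ}
    (h : HasEmptyRect A s t) (hγ : 0 ≤ γ) (hγ1 : γ ≤ 1) {m : ℕ} (hs : γ * m ≤ s)
    (ht : (1 - γ) * m + 1 ≤ t) : m ≤ maxGammaBalanced γ (bipGraph A) := by
  classical
  obtain ⟨S, T, hE, hS, hT⟩ := h
  have hfl : (⌊γ * (m : ℝ)⌋₊ : ℝ) ≤ γ * m := Nat.floor_le (by positivity)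
  have hfl' := Nat.lt_floor_add_one (γ * (m : ℝ))
  have hfm : ⌊γ * (m : ℝ)⌋₊ ≤ m := by
    have : (⌊γ * (m : ℝ)⌋₊ : ℝ) ≤ m := hfl.trans (mul_le_of_le_one_left (Nat.cast_nonneg m) hγ1)
    exact_mod_cast this
  have h1 : ⌊γ * (m : ℝ)⌋₊ ≤ S.card := by
    have : (⌊γ * (m : ℝ)⌋₊ : ℝ) ≤ S.card := by linarith
    exact_mod_cast this
  have h2 : m - ⌊γ * (m : ℝ)⌋₊ ≤ T.card := by
    have : ((m - ⌊γ * (m : ℝ)⌋₊ : ℕ) : ℝ) ≤ T.card := by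
      rw [Nat.cast_sub hfm]; linarith
    exact_mod_cast this
  obtain ⟨S', hS', hSc⟩ := Finset.exists_subset_card_eq h1
  obtain ⟨T', hT', hTc⟩ := Finset.exists_subset_card_eq h2
  have hc : (S'.disjSum T').card = m := by rw [Finset.card_disjSum, hSc, hTc]; omega
  rw [maxGammaBalanced, ← hc]
  refine Finset.le_sup (f := Finset.card) (Finset.mem_filter.2 ⟨Finset.mem_univ _, ?_, ?_⟩)
  · exact (hE.mono hS' hT').isIndepSet_disjSum
  · rw [hc, Finset.toLeft_disjSum, hSc, abs_lt]
    constructor <;> linarith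

lemma HasEmptyRect.le_maxBalanced {n : ℕ} {A : Fin n × Fin n → Bool} {s t : ℝ}
    (h : HasEmptyRect A s t) {m : ℕ} (hs : m ≤ s) (ht : m ≤ t) :
    2 * m ≤ maxBalanced (bipGraph A) := by
  classical
  obtain ⟨S, T, hE, hS, hT⟩ := h
  obtain ⟨S', hS', hSc⟩ := Finset.exists_subset_card_eq
    (by exact_mod_cast hs.trans hS : m ≤ S.card)
  obtain ⟨T', hT', hTc⟩ := Finset.exists_subset_card_eq
    (by exact_mod_cast ht.trans hT : m ≤ T.card)
  have hc : (S'.disjSum T').card = 2 * m := by rw [Finset.card_disjSum, hSc, hTc]; omega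
  rw [maxBalanced, ← hc]
  refine Finset.le_sup (f := Finset.card) (Finset.mem_filter.2 ⟨Finset.mem_univ _, ?_, ?_⟩)
  · exact (hE.mono hS' hT').isIndepSet_disjSum
  · rw [Finset.toLeft_disjSum, Finset.toRight_disjSum, hSc, hTc]

lemma maxBalanced_le_maxGammaBalanced {n : ℕ} (G : SimpleGraph (Vertex n)) :
    maxBalanced G ≤ maxGammaBalanced (1 / 2) G := by
  classical
  refine Finset.sup_mono (Finset.monotone_filter_right _ fun I _ hI => ⟨hI.1, ?_⟩)
  have hcard : (I.toLeft.card : ℝ) + I.toRight.card = I.card := by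
    exact_mod_cast Finset.card_toLeft_add_card_toRight
  have : (I.toLeft.card : ℝ) = I.toRight.card := by exact_mod_cast hI.2
  rw [abs_lt]
  constructor <;> linarith

/-! ### Events of high probability -/

/-- High-probability events in terms of the edge indicators. -/
def WhpPairs (d : ℝ) (P : ∀ n : ℕ, (Fin n × Fin n → Bool) → Prop) : Prop :=
  Tendsto (fun n : ℕ => (bipLaw n d).real {A | P n A}) atTop (𝓝 1)

lemma WhpPairs.mono {d : ℝ} {P Q : ∀ n : ℕ, (Fin n × Fin n → Bool) → Prop} (h : WhpPairs d P)
    (hPQ : ∀ᶠ n in atTop, ∀ A, P n A → Q n A) : WhpPairs d Q := by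
  refine tendsto_of_tendsto_of_tendsto_of_le_of_le' h tendsto_const_nhds ?_
    (Eventually.of_forall fun n => measureReal_le_one)
  filter_upwards [hPQ] with n hn
  exact measureReal_mono fun A hA => hn A hA

lemma WhpPairs.and {d : ℝ} {P Q : ∀ n : ℕ, (Fin n × Fin n → Bool) → Prop} (hP : WhpPairs d P)
    (hQ : WhpPairs d Q) : WhpPairs d fun n A => P n A ∧ Q n A := by
  have hlim : Tendsto (fun n : ℕ => (bipLaw n d).real {A | P n A}
      + (bipLaw n d).real {A | Q n A} - 1) atTop (𝓝 1) := by
    simpa using (Tendsto.add hP hQ).sub_const 1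
  refine tendsto_of_tendsto_of_tendsto_of_le_of_le hlim tendsto_const_nhds (fun n => ?_)
    (fun n => measureReal_le_one)
  have h1 := measureReal_union_add_inter (μ := bipLaw n d) (s := {A | P n A}) (t := {A | Q n A})
    MeasurableSet.of_discrete
  have h2 : (bipLaw n d).real ({A | P n A} ∪ {A | Q n A}) ≤ 1 := measureReal_le_one
  have h3 : {A | P n A ∧ Q n A} = {A | P n A} ∩ {A | Q n A} := rfl
  simp only [h3]
  linarith

lemma whpPairs_not {d : ℝ} {P : ∀ n : ℕ, (Fin n × Fin n → Bool) → Prop}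
    (h : Tendsto (fun n : ℕ => (bipLaw n d).real {A | P n A}) atTop (𝓝 0)) :
    WhpPairs d fun n A => ¬ P n A := by
  have h1 : Tendsto (fun n : ℕ => 1 - (bipLaw n d).real {A | P n A}) atTop (𝓝 1) := by
    simpa using h.const_sub 1
  refine h1.congr fun n => ?_
  have := measureReal_compl (μ := bipLaw n d) (s := {A | P n A}) (MeasurableSet.of_discrete)
  rw [Set.compl_ofPred, probReal_univ] at this
  exact this.symm

/-! ### Asymptotics for large average degree -/

lemma tendsto_log_div_id : Tendsto (fun d : ℝ => Real.log d / d) atTop (𝓝 0) := by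
  simpa using (Real.isLittleO_log_id_atTop).tendsto_div_nhds_zero

lemma tendsto_log_sq_div_id : Tendsto (fun d : ℝ => Real.log d ^ 2 / d) atTop (𝓝 0) := by
  simpa using (Real.isLittleO_pow_log_id_atTop (n := 2)).tendsto_div_nhds_zero

lemma tendsto_log_sq_mul_exp {c : ℝ} (hc : 0 < c) :
    Tendsto (fun d : ℝ => Real.log d ^ 2 * Real.exp (-c * Real.log d)) atTop (𝓝 0) := by
  have h := (tendsto_rpow_mul_exp_neg_mul_atTop_nhds_zero 2 c hc).comp Real.tendsto_log_atTop
  simpa [Function.comp_def] using h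

/-- Above the threshold there are no empty rectangles. -/
lemma eventually_whpPairs_not_hasEmptyRect {γ K : ℝ} (hγ : 0 < γ) (hγ1 : γ < 1)
    (hK : 1 < γ * (1 - γ) * K) :
    ∀ᶠ d : ℝ in atTop, WhpPairs d fun n A => ¬ HasEmptyRect A
      (γ * (K * (Real.log d / d)) * n - 1) ((1 - γ) * (K * (Real.log d / d)) * n - 1) := by
  have hγ' : 0 < 1 - γ := by linarith
  have hK0 : 0 < K := by
    by_contra h
    have : γ * (1 - γ) * K ≤ 0 := mul_nonpos_of_nonneg_of_nonpos (by positivity) (not_lt.1 h)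
    linarith
  have hsmall : Tendsto (fun d : ℝ => K * (Real.log d / d)) atTop (𝓝 0) := by
    simpa using tendsto_log_div_id.const_mul K
  have hbig : ∀ c : ℝ, 0 < c → ∀ᶠ d : ℝ in atTop, Real.exp 1 ≤ c * Real.log d := fun c hc =>
    (Real.tendsto_log_atTop.const_mul_atTop hc).eventually_ge_atTop _
  filter_upwards [eventually_gt_atTop 0, hsmall.eventually_le_const zero_lt_one,
    hbig (γ * K) (by positivity), hbig ((1 - γ) * K) (by positivity),
    Real.tendsto_log_atTop.eventually_gt_atTop 0] with d hd hσ1 hea heb hL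
  set L := Real.log d with hLdef
  set σ := K * (L / d) with hσ
  have hσ0 : 0 < σ := by positivity
  have hσd : σ * d = K * L := by rw [hσ]; field_simp
  -- From `uσd = uKL ≥ e` one gets `log (1/(uσ)) ≤ L - 1`, and this `-1` absorbs the linear entropy
  -- term.
  have hlog : ∀ u : ℝ, 0 < u → Real.exp 1 ≤ u * K * L →
      u * σ + u * σ * Real.log (1 / (u * σ)) ≤ u * σ * L := by
    intro u hu he
    have hpos : 0 < u * σ := by positivity
    have h1 : Real.log (1 / (u * σ)) ≤ L - 1 := by
      have hdiv : L - 1 = Real.log (d / Real.exp 1) := by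
        rw [Real.log_div hd.ne' (Real.exp_pos _).ne', Real.log_exp]
      rw [hdiv]
      refine Real.log_le_log (by positivity) ?_
      rw [div_le_div_iff₀ hpos (Real.exp_pos _), one_mul]
      calc Real.exp 1 ≤ u * K * L := he
        _ = d * (u * σ) := by rw [mul_assoc, ← hσd]; ring
    linarith [mul_le_mul_of_nonneg_left h1 hpos.le]
  refine whpPairs_not (tendsto_hasEmptyRect_zero hd (by positivity) ?_ (by positivity) ?_ ?_)
  · exact mul_le_one₀ hγ1.le hσ0.le hσ1
  · exact mul_le_one₀ (by linarith) hσ0.le hσ1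
  · have h1 := hlog γ hγ hea
    have h2 := hlog (1 - γ) hγ' heb
    have h3 : d * (γ * σ * ((1 - γ) * σ)) = σ * L * (γ * (1 - γ) * K) := by
      calc d * (γ * σ * ((1 - γ) * σ)) = γ * (1 - γ) * σ * (σ * d) := by ring
        _ = _ := by rw [hσd]; ring
    have h4 : σ * L * 1 < σ * L * (γ * (1 - γ) * K) := mul_lt_mul_of_pos_left hK (by positivity)
    rw [h3]
    linarith

/-- Below the threshold there are empty rectangles. -/
lemma eventually_whpPairs_hasEmptyRect {γ K : ℝ} (hγ : 0 < γ) (hγ1 : γ < 1) (hK0 : 0 < K)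
    (hK : γ * (1 - γ) * K < 1) :
    ∀ᶠ d : ℝ in atTop, WhpPairs d fun n A => HasEmptyRect A
      (γ * (K * (Real.log d / d)) * n) ((1 - γ) * (K * (Real.log d / d)) * n) := by
  have hγ' : 0 < 1 - γ := by linarith
  have hg : 0 < γ * (1 - γ) := by positivity
  obtain ⟨K₁, hKK₁, hK₁⟩ : ∃ K₁, K < K₁ ∧ γ * (1 - γ) * K₁ < 1 := by
    obtain ⟨K₁, h1, h2⟩ := exists_between ((lt_div_iff₀' hg).2 hK)
    exact ⟨K₁, h1, (lt_div_iff₀' hg).1 h2⟩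
  have hK₁0 : 0 < K₁ := hK0.trans hKK₁
  set η := 1 - γ * (1 - γ) * K₁ with hη
  have hη0 : 0 < η := by linarith
  have hη1 : η < 1 := by
    have : 0 < γ * (1 - γ) * K₁ := by positivity
    linarith
  -- Half of the left-hand gap between `K₁` and `K` pays for `τ`, the other half absorbs the `-1`.
  set κ := γ * (K₁ - K) / 2 with hκ
  have hκ0 : 0 < κ := by have := sub_pos.2 hKK₁; positivity
  have hsmall : Tendsto (fun d : ℝ => K₁ * (Real.log d / d)) atTop (𝓝 0) := by
    simpa using tendsto_log_div_id.const_mul K₁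
  have hsmallτ : Tendsto (fun d : ℝ => κ * (Real.log d / d)) atTop (𝓝 0) := by
    simpa using tendsto_log_div_id.const_mul κ
  have hexp : Tendsto (fun d : ℝ => Real.exp 1 * K₁ ^ 2 * (1 + η / 2) *
      (Real.log d ^ 2 * Real.exp (-(η / 2) * Real.log d))) atTop (𝓝 0) := by
    simpa using (tendsto_log_sq_mul_exp (half_pos hη0)).const_mul
      (Real.exp 1 * K₁ ^ 2 * (1 + η / 2))
  have hsq : Tendsto (fun d : ℝ => (1 + η / 2) * Real.exp 1 ^ 4 * K₁ ^ 4 *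
      (Real.log d ^ 2 / d)) atTop (𝓝 0) := by
    simpa only [mul_zero] using
      tendsto_log_sq_div_id.const_mul ((1 + η / 2) * Real.exp 1 ^ 4 * K₁ ^ 4)
  have hΛ : Tendsto (fun d : ℝ => (1 - η / 2) * Real.log d) atTop atTop :=
    Real.tendsto_log_atTop.const_mul_atTop (by linarith)
  filter_upwards [eventually_gt_atTop 0, hsmall.eventually_le_const zero_lt_one,
    hsmallτ.eventually_le_const (by norm_num : (0 : ℝ) < 4), hexp.eventually_lt_const zero_lt_one,
    hsq.eventually_lt_const (by positivity : 0 < κ ^ 2 / 8), hΛ.eventually_ge_atTop 1,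
    Real.tendsto_log_atTop.eventually_gt_atTop 0] with d hd hσ1 hτ4 hE hS hΛ1 hL
  set L := Real.log d with hLdef
  have hdL : Real.exp L = d := Real.exp_log hd
  set σ := K₁ * (L / d) with hσ
  have hσ0 : 0 < σ := by positivity
  have hsub : ∀ u : ℝ, 0 < u → u < 1 → Real.exp ((1 - η / 2) * L) *
      (Real.exp 1 * (u * σ) ^ 2) * ((1 + η / 2) * d) < 1 := by
    intro u hu hu1
    have hexpL : Real.exp ((1 - η / 2) * L) = d * Real.exp (-(η / 2) * L) := by
      calc Real.exp ((1 - η / 2) * L) = Real.exp L * Real.exp (-(η / 2) * L) := by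
            rw [← Real.exp_add]; ring_nf
        _ = _ := by rw [hdL]
    have hle : (u * σ) ^ 2 ≤ σ ^ 2 := by
      gcongr
      exact mul_le_of_le_one_left hσ0.le hu1.le
    refine lt_of_le_of_lt ?_ hE
    calc Real.exp ((1 - η / 2) * L) * (Real.exp 1 * (u * σ) ^ 2) * ((1 + η / 2) * d)
        ≤ Real.exp ((1 - η / 2) * L) * (Real.exp 1 * σ ^ 2) * ((1 + η / 2) * d) := by gcongr
      _ = _ := by rw [hexpL, hσ]; field_simp
  -- The slack `η` is split between `D` and `Λ`: `(1 + η/2)(1 - η) ≤ 1 - η/2` gives `h3`, while `exp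
  -- Λ · σ² · D` is of order `(log d)² d^(-η/2)`.
  have hmain := tendsto_hasEmptyRect_one (a := γ * σ) (b := (1 - γ) * σ) (d := d)
    (D := (1 + η / 2) * d) (Λ := (1 - η / 2) * L) (τ := κ * (L / d)) hd
    (by nlinarith) (by positivity) (mul_le_one₀ hγ1.le hσ0.le hσ1) (by positivity)
    (mul_le_one₀ (by linarith) hσ0.le hσ1) hΛ1 (hsub γ hγ hγ1) (hsub (1 - γ) hγ' (by linarith))
    ?_ (by positivity) hτ4 ?_
  · refine WhpPairs.mono hmain ?_
    have hc : 0 < κ * (L / d) := by positivity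
    have hc' : 0 < (1 - γ) * (K₁ - K) * (L / d) := by
      have := sub_pos.2 hKK₁; positivity
    filter_upwards [(tendsto_natCast_atTop_atTop.const_mul_atTop hc).eventually_ge_atTop (1 : ℝ),
      (tendsto_natCast_atTop_atTop.const_mul_atTop hc').eventually_ge_atTop (1 : ℝ)] with n h1 h2
    rintro A ⟨S, T, hER, hS', hT'⟩
    refine ⟨S, T, hER, le_trans ?_ hS', le_trans ?_ hT'⟩
    · have : (γ * σ - κ * (L / d)) * n - 1
          = γ * (K * (L / d)) * n + (κ * (L / d) * n - 1) := by rw [hσ, hκ]; ring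
      linarith
    · have : (1 - γ) * σ * n - 1
          = (1 - γ) * (K * (L / d)) * n + ((1 - γ) * (K₁ - K) * (L / d) * n - 1) := by
        rw [hσ]; ring
      linarith
  · have hσd : σ * d = K₁ * L := by rw [hσ]; field_simp
    calc (1 + η / 2) * d * (γ * σ * ((1 - γ) * σ))
        = (1 + η / 2) * (γ * (1 - γ)) * σ * (σ * d) := by ring
      _ = (1 + η / 2) * (γ * (1 - γ) * K₁) * (σ * L) := by rw [hσd]; ring
      _ = (1 + η / 2) * (1 - η) * (σ * L) := by rw [hη]; ring
      _ ≤ (1 - η / 2) * (σ * L) := by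
          refine mul_le_mul_of_nonneg_right ?_ (by positivity)
          nlinarith
      _ = (1 - η / 2) * L * (γ * σ + (1 - γ) * σ) := by ring
  · have hle : (γ * σ) ^ 2 ≤ σ ^ 2 := by
      gcongr
      exact mul_le_of_le_one_left hσ0.le hγ1.le
    have hle' : ((1 - γ) * σ) ^ 2 ≤ σ ^ 2 := by
      gcongr
      exact mul_le_of_le_one_left hσ0.le (by linarith)
    calc (1 + η / 2) * d * (Real.exp 1 * (Real.exp 1 * (γ * σ) ^ 2)) *
          (Real.exp 1 * (Real.exp 1 * ((1 - γ) * σ) ^ 2))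
        ≤ (1 + η / 2) * d * (Real.exp 1 * (Real.exp 1 * σ ^ 2)) *
          (Real.exp 1 * (Real.exp 1 * σ ^ 2)) := by gcongr
      _ = (1 + η / 2) * Real.exp 1 ^ 4 * K₁ ^ 4 * (L ^ 2 / d) * (L / d) ^ 2 := by
          rw [hσ]; field_simp
      _ < κ ^ 2 / 8 * (L / d) ^ 2 := mul_lt_mul_of_pos_right hS (by positivity)
      _ = (κ * (L / d)) ^ 2 / 8 := by ring

/-! ### The largest balanced independent sets -/

lemma eventually_whp_maxGammaBalanced_le {γ K : ℝ} (hγ : 0 < γ) (hγ1 : γ < 1)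
    (hK : 1 < γ * (1 - γ) * K) :
    ∀ᶠ d : ℝ in atTop, WhpPairs d fun n A =>
      (maxGammaBalanced γ (bipGraph A) : ℝ) ≤ K * (Real.log d / d) * n := by
  filter_upwards [eventually_whpPairs_not_hasEmptyRect hγ hγ1 hK] with d hd
  refine hd.mono (Eventually.of_forall fun n A hA => ?_)
  by_contra hlt
  push Not at hlt
  refine hA ?_
  have := hasEmptyRect_of_le_maxGammaBalanced hγ.le hγ1.le hlt.le
  rwa [← mul_assoc, ← mul_assoc (1 - γ)] at this

/-- A positive constant strictly between `K` and the threshold. -/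
lemma exists_gap {γ K : ℝ} (hg : 0 < γ * (1 - γ)) (hK : γ * (1 - γ) * K < 1) :
    ∃ K₁, 0 < K₁ ∧ max K 0 < K₁ ∧ γ * (1 - γ) * K₁ < 1 := by
  have : max K 0 < 1 / (γ * (1 - γ)) := max_lt ((lt_div_iff₀' hg).2 hK) (by positivity)
  obtain ⟨K₁, h1, h2⟩ := exists_between this
  exact ⟨K₁, lt_of_le_of_lt (le_max_right _ _) h1, h1, (lt_div_iff₀' hg).1 h2⟩

lemma eventually_whp_le_maxGammaBalanced {γ K : ℝ} (hγ : 0 < γ) (hγ1 : γ < 1)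
    (hK : γ * (1 - γ) * K < 1) :
    ∀ᶠ d : ℝ in atTop, WhpPairs d fun n A =>
      K * (Real.log d / d) * n ≤ (maxGammaBalanced γ (bipGraph A) : ℝ) := by
  have hγ' : 0 < 1 - γ := by linarith
  obtain ⟨K₁, hK₁0, hKK₁, hK₁⟩ := exists_gap (by positivity) hK
  filter_upwards [eventually_whpPairs_hasEmptyRect hγ hγ1 hK₁0 hK₁, eventually_gt_atTop 0,
    Real.tendsto_log_atTop.eventually_gt_atTop 0] with d hd hd0 hL
  have hr : 0 < Real.log d / d := by positivity
  set r := Real.log d / d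
  -- `K` may be negative, hence `max K 0`. The slack, eventually at least `2`, covers the ceiling in
  -- `m` and the extra right-hand vertex.
  have hc : 0 < (1 - γ) * ((K₁ - max K 0) * r) := by
    have := sub_pos.2 hKK₁; positivity
  refine hd.mono ?_
  filter_upwards [(tendsto_natCast_atTop_atTop.const_mul_atTop hc).eventually_ge_atTop (2 : ℝ)]
    with n hn A hA
  have hn0 : (0 : ℝ) ≤ n := Nat.cast_nonneg n
  set m := ⌈max K 0 * r * n⌉₊
  have hm : (m : ℝ) < max K 0 * r * n + 1 :=
    Nat.ceil_lt_add_one (mul_nonneg (mul_nonneg (le_max_right _ _) hr.le) hn0)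
  have hm' : max K 0 * r * n ≤ m := Nat.le_ceil _
  have hgap : 2 ≤ (K₁ - max K 0) * r * n := by
    have hx : 0 ≤ (K₁ - max K 0) * r * n := by
      have := sub_pos.2 hKK₁; positivity
    nlinarith
  have hle : m ≤ maxGammaBalanced γ (bipGraph A) := by
    refine hA.le_maxGammaBalanced hγ.le hγ1.le ?_ ?_
    · rw [mul_assoc]
      exact mul_le_mul_of_nonneg_left (by linarith) hγ.le
    · have := mul_le_mul_of_nonneg_left hm.le hγ'.le
      linarith
  calc K * r * n ≤ max K 0 * r * n := by gcongr; exact le_max_left _ _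
    _ ≤ m := hm'
    _ ≤ _ := by exact_mod_cast hle

lemma eventually_whp_le_maxBalanced {K : ℝ} (hK : K < 4) :
    ∀ᶠ d : ℝ in atTop, WhpPairs d fun n A =>
      K * (Real.log d / d) * n ≤ (maxBalanced (bipGraph A) : ℝ) := by
  obtain ⟨K₁, hK₁0, hKK₁, hK₁⟩ := exists_gap (γ := 1 / 2) (K := K) (by norm_num) (by linarith)
  filter_upwards [eventually_whpPairs_hasEmptyRect (by norm_num) (by norm_num) hK₁0 hK₁,
    eventually_gt_atTop 0, Real.tendsto_log_atTop.eventually_gt_atTop 0] with d hd hd0 hL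
  have hr : 0 < Real.log d / d := by positivity
  set r := Real.log d / d
  have hc : 0 < (K₁ - max K 0) * r := by
    have := sub_pos.2 hKK₁; positivity
  refine hd.mono ?_
  filter_upwards [(tendsto_natCast_atTop_atTop.const_mul_atTop hc).eventually_ge_atTop (2 : ℝ)]
    with n hn A hA
  have hn0 : (0 : ℝ) ≤ n := Nat.cast_nonneg n
  set m := ⌈max K 0 * r * n / 2⌉₊
  have hm : (m : ℝ) < max K 0 * r * n / 2 + 1 :=
    Nat.ceil_lt_add_one (div_nonneg (mul_nonneg (mul_nonneg (le_max_right _ _) hr.le) hn0)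
      zero_le_two)
  have hm' : max K 0 * r * n / 2 ≤ m := Nat.le_ceil _
  have hle : 2 * m ≤ maxBalanced (bipGraph A) := hA.le_maxBalanced (by linarith) (by linarith)
  have hle' : (2 * m : ℝ) ≤ maxBalanced (bipGraph A) := by exact_mod_cast hle
  calc K * r * n ≤ max K 0 * r * n := by gcongr; exact le_max_left _ _
    _ ≤ 2 * m := by linarith
    _ ≤ _ := hle'

/-- A property that holds eventually for every `ε > 0` holds eventually for some `ε = δ d → 0`. -/
lemma exists_tendsto_zero_of_eventually {P : ℝ → ℝ → Prop}
    (h : ∀ ε > 0, ∀ᶠ d in atTop, P ε d)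
    (hmono : ∀ᶠ d in atTop, ∀ ε ε', ε ≤ ε' → P ε d → P ε' d) :
    ∃ δ : ℝ → ℝ, Tendsto δ atTop (𝓝 0) ∧ ∀ᶠ d in atTop, P (δ d) d := by
  have hbdd : ∀ d, BddBelow {ε | 0 < ε ∧ P ε d} := fun d => ⟨0, fun ε hε => hε.1.le⟩
  have hnn : ∀ d, 0 ≤ sInf {ε | 0 < ε ∧ P ε d} := fun d => Real.sInf_nonneg fun ε hε => hε.1.le
  have hinf : Tendsto (fun d => sInf {ε | 0 < ε ∧ P ε d}) atTop (𝓝 0) := by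
    rw [Metric.tendsto_nhds]
    intro ε hε
    filter_upwards [h (ε / 2) (half_pos hε)] with d hd
    rw [Real.dist_eq, sub_zero, abs_of_nonneg (hnn d)]
    exact (csInf_le (hbdd d) ⟨half_pos hε, hd⟩).trans_lt (half_lt_self hε)
  -- The infimum need not be attained; adding `1/d` moves strictly past it and still tends to zero.
  refine ⟨fun d => sInf {ε | 0 < ε ∧ P ε d} + d⁻¹, ?_, ?_⟩
  · simpa using hinf.add tendsto_inv_atTop_zero
  · filter_upwards [h 1 one_pos, hmono, eventually_gt_atTop 0] with d h1 hm hd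
    have hlt : sInf {ε | 0 < ε ∧ P ε d} < sInf {ε | 0 < ε ∧ P ε d} + d⁻¹ :=
      lt_add_of_pos_right _ (inv_pos.2 hd)
    obtain ⟨ε, hε, hεlt⟩ := exists_lt_of_csInf_lt (s := {ε | 0 < ε ∧ P ε d}) ⟨1, one_pos, h1⟩ hlt
    exact hm ε _ hεlt.le hε.2

lemma le_div_two_mul_iff {n : ℕ} (hn : 0 < n) (c x : ℝ) :
    c ≤ x / (2 * (n : ℝ)) ↔ 2 * c * n ≤ x := by
  have hn' : (0 : ℝ) < n := by exact_mod_cast hn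
  rw [le_div_iff₀ (by positivity)]
  constructor <;> intro h <;> linarith

lemma div_two_mul_le_iff {n : ℕ} (hn : 0 < n) (c x : ℝ) :
    x / (2 * (n : ℝ)) ≤ c ↔ x ≤ 2 * c * n := by
  have hn' : (0 : ℝ) < n := by exact_mod_cast hn
  rw [div_le_iff₀ (by positivity)]
  constructor <;> intro h <;> linarith

lemma eventually_whp_maxGammaBalanced {γ ε : ℝ} (hγ : 0 < γ) (hγ1 : γ < 1) (hε : 0 < ε) :
    ∀ᶠ d : ℝ in atTop, WhpPairs d fun n A =>
      (1 / (2 * γ * (1 - γ)) - ε) * (Real.log d / d)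
          ≤ (maxGammaBalanced γ (bipGraph A) : ℝ) / (2 * (n : ℝ)) ∧
        (maxGammaBalanced γ (bipGraph A) : ℝ) / (2 * (n : ℝ))
          ≤ (1 / (2 * γ * (1 - γ)) + ε) * (Real.log d / d) := by
  have hγ' : 0 < 1 - γ := by linarith
  have hg : 0 < γ * (1 - γ) * (2 * ε) := by positivity
  have hone : γ * (1 - γ) * (2 * (1 / (2 * γ * (1 - γ)))) = 1 := by field_simp
  -- Densities are relative to `2n` vertices, so the constants double.
  filter_upwards [eventually_whp_le_maxGammaBalanced (K := 2 * (1 / (2 * γ * (1 - γ)) - ε)) hγ hγ1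
      (by rw [mul_sub 2, mul_sub _ (2 * _), hone]; linarith),
    eventually_whp_maxGammaBalanced_le (K := 2 * (1 / (2 * γ * (1 - γ)) + ε)) hγ hγ1
      (by rw [mul_add 2, mul_add _ (2 * _), hone]; linarith)] with d h1 h2
  refine (h1.and h2).mono ?_
  filter_upwards [eventually_gt_atTop 0] with n hn A hA
  rw [le_div_two_mul_iff hn, div_two_mul_le_iff hn, ← mul_assoc, ← mul_assoc]
  exact hA

end BalancedIndep

theorem theorem1p3 :
    (∀ γ : ℝ, 0 < γ → γ ≤ 1 / 2 → ∀ ε : ℝ, 0 < ε → ∃ d₀ : ℝ, ∀ d : ℝ, d₀ ≤ d →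
      BalancedIndep.Whp d fun n G =>
        (1 / (2 * γ * (1 - γ)) - ε) * (Real.log d / d)
            ≤ (BalancedIndep.maxGammaBalanced γ G : ℝ) / (2 * (n : ℝ)) ∧
          (BalancedIndep.maxGammaBalanced γ G : ℝ) / (2 * (n : ℝ))
            ≤ (1 / (2 * γ * (1 - γ)) + ε) * (Real.log d / d)) ∧
    (∃ δ : ℝ → ℝ, Tendsto δ atTop (𝓝 0) ∧ ∃ d₀ : ℝ, ∀ d : ℝ, d₀ ≤ d →
      BalancedIndep.Whp d fun n G =>
        ((2 - δ d) * (Real.log d / d)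
            ≤ (BalancedIndep.maxGammaBalanced (1 / 2) G : ℝ) / (2 * (n : ℝ)) ∧
          (BalancedIndep.maxGammaBalanced (1 / 2) G : ℝ) / (2 * (n : ℝ))
            ≤ (2 + δ d) * (Real.log d / d)) ∧
        ((2 - δ d) * (Real.log d / d)
            ≤ (BalancedIndep.maxBalanced G : ℝ) / (2 * (n : ℝ)) ∧
          (BalancedIndep.maxBalanced G : ℝ) / (2 * (n : ℝ))
            ≤ (2 + δ d) * (Real.log d / d))) := by
  refine ⟨fun γ hγ hγ2 ε hε => eventually_atTop.1
    (BalancedIndep.eventually_whp_maxGammaBalanced hγ (by linarith) hε), ?_⟩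
  -- Both notions of balance are put into one property, so that a single `δ` serves both.
  refine (BalancedIndep.exists_tendsto_zero_of_eventually
    (P := fun ε d => BalancedIndep.WhpPairs d fun n A =>
      ((2 - ε) * (Real.log d / d)
            ≤ (BalancedIndep.maxGammaBalanced (1 / 2) (BalancedIndep.bipGraph A) : ℝ)
              / (2 * (n : ℝ)) ∧
          (BalancedIndep.maxGammaBalanced (1 / 2) (BalancedIndep.bipGraph A) : ℝ) / (2 * (n : ℝ))
            ≤ (2 + ε) * (Real.log d / d)) ∧
        ((2 - ε) * (Real.log d / d)
            ≤ (BalancedIndep.maxBalanced (BalancedIndep.bipGraph A) : ℝ) / (2 * (n : ℝ)) ∧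
          (BalancedIndep.maxBalanced (BalancedIndep.bipGraph A) : ℝ) / (2 * (n : ℝ))
            ≤ (2 + ε) * (Real.log d / d))) ?_ ?_).imp fun δ h => ⟨h.1, eventually_atTop.1 h.2⟩
  · intro ε hε
    filter_upwards [BalancedIndep.eventually_whp_maxGammaBalanced (γ := 1 / 2) (by norm_num)
      (by norm_num) hε, BalancedIndep.eventually_whp_le_maxBalanced (K := 2 * (2 - ε))
      (by linarith)] with d h1 h2
    refine (h1.and h2).mono ?_
    filter_upwards [eventually_gt_atTop 0] with n hn A hA
    obtain ⟨⟨hlo, hup⟩, hbal⟩ := hA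
    have hconst : (1 : ℝ) / (2 * (1 / 2) * (1 - 1 / 2)) = 2 := by norm_num
    rw [hconst] at hlo hup
    refine ⟨⟨hlo, hup⟩, ?_, le_trans ?_ hup⟩
    · rw [BalancedIndep.le_div_two_mul_iff hn, ← mul_assoc]
      exact hbal
    · gcongr
      exact BalancedIndep.maxBalanced_le_maxGammaBalanced _
  -- Weakening `ε` weakens the bounds only where `log d ≥ 0`.
  · filter_upwards [eventually_ge_atTop 1] with d hd ε ε' hle hP
    have hr : 0 ≤ Real.log d / d := div_nonneg (Real.log_nonneg hd) (by linarith)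
    have h1 : (2 - ε') * (Real.log d / d) ≤ (2 - ε) * (Real.log d / d) :=
      mul_le_mul_of_nonneg_right (by linarith) hr
    have h2 : (2 + ε) * (Real.log d / d) ≤ (2 + ε') * (Real.log d / d) :=
      mul_le_mul_of_nonneg_right (by linarith) hr
    refine hP.mono (Eventually.of_forall fun n A hA => ?_)
    exact ⟨⟨h1.trans hA.1.1, hA.1.2.trans h2⟩, h1.trans hA.2.1, hA.2.2.trans h2⟩
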